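/- Let $X$ be a smooth, projective, geometrically irreducible curve over the finite field $\mathbb{F}_q$ with function field $K$, let $\infty\in X(\mathbb{F}_q)$, and let $A=\mathcal{O}_X(X\setminus\{\infty\})$. Let $v_\infty$ be the normalized valuation of $K$ at $\infty$, let $K_\infty$ be the completion of $K$ for the norm $\|x\|=q^{-v_\infty(x)}$, and let $\mathbb{C}_\infty$ be the completion of an algebraic closure of $K_\infty$. Write $\tau:x\mapsto x^q$ for the Frobenius automorphism of $\mathbb{C}_\infty$. Let $\Lambda\subseteq\mathbb{C}_\infty$ be a finitely generated discrete $A$-submodule, and write its exponential as $$\exp_\Lambda(x)=x\prod_{\lambda\in\Lambda\setminus\{0\}}\Bigl(1-\frac{x}{\lambda}\Bigr)=\sum_{i\ge 0}e_i x^{q^i},\qquad\text{i.e. } \exp_\Lambda=\sum_{i\ge0} e_i\tau^i\in\mathbb{C}_\infty[[\tau]].$$ For $f=\sum_i f_i\tau^i\in\mathbb{C}_\infty[[\tau]]$ put $f^*=\sum_i\tau^{-i}f_i=\sum_i f_i^{q^{-i}}\tau^{-i}\in\mathbb{C}_\infty[[\tau^{-1}]]$. Let $\ker\exp_\Lambda^*$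 be the set of $\beta\in\mathbb{C}_\infty$ with $\sum_i (e_i\beta)^{q^{-i}}=0$. For $\beta\in\mathbb{C}_\infty$ let $g_\beta\in\mathbb{C}_\infty[[\tau]]$ be the unique series with $\exp_\Lambda^*\circ\beta=g_\beta^*\circ(1-\tau^{-1})$ in $\mathbb{C}_\infty[[\tau^{-1}]]$ (so $g_0=0$). (1) For every $\beta\in\ker\exp_\Lambda^*$ with $\beta\neq0$, the series $g_\beta$ converges at every $\lambda\in\Lambda$, and $$\beta=-\sum_{\lambda\in\Lambda\setminus\{0\}}\frac{g_\beta(\lambda)}{\lambda},$$ where the sum converges unconditionally in $\mathbb{C}_\infty$. (2) This gives an explicit inverse of Poonen's map: $\beta\mapsto g_\beta|_\Lambda$ is a bijection from $\ker\exp_\Lambda^*$ onto the set $\mathrm{Hom}_{\mathbb{F}_q}(\Lambda,\mathbb{F}_q)$ of $\mathbb{F}_q$-linear maps, and its inverse sends $f$ to $-\sum_{\lambda\in\Lambda\setminus\{0\}}f(\lambda)/\lambda$, the sum converging unconditionally. -/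

import Mathlib

noncomputable section

/-! ## The curve, the point at infinity, and the ring `A`

A smooth projective geometrically irreducible curve over the finite field `Fq` is given by its
function field `K`; its closed points are the discrete valuation rings of `K` over `Fq`. -/

/-- `K` is the function field of a smooth, projective, geometrically irreducible curve over `Fq`:
a finitely generated extension of transcendence degree one in which `Fq` is algebraically closed. -/
structure IsCurveFunctionField (Fq K : Type*) [Field Fq] [Field K] [Algebra Fq K] : Prop where
  finitelyGenerated : (⊤ : IntermediateField Fq K).FG
  trdeg_eq_one : Algebra.trdeg Fq K = 1
  constants : ∀ x : K, IsAlgebraic Fq x → x ∈ Set.range (algebraMap Fq K)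

/-- A closed point of the curve with function field `K`: its local ring in `K`. -/
@[ext]
structure ClosedPoint (Fq K : Type*) [Field Fq] [Field K] [Algebra Fq K] where
  localRing : ValuationSubring K
  algebraMap_mem : ∀ c : Fq, algebraMap Fq K c ∈ localRing
  isDVR : IsDiscreteValuationRing localRing

attribute [instance] ClosedPoint.isDVR

namespace ClosedPoint

variable {Fq K : Type*} [Field Fq] [Field K] [Algebra Fq K]

/-- The point is `Fq`-rational: its residue field is `Fq`. -/
def IsRational (P : ClosedPoint Fq K) : Prop :=
  ∀ x ∈ P.localRing, ∃ c : Fq, P.localRing.valuation (x - algebraMap Fq K c) < 1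

/-- The ring `A` of functions which are regular away from the point `P`. -/
def ringAway (P : ClosedPoint Fq K) : Subalgebra Fq K where
  carrier := {x | ∀ Q : ClosedPoint Fq K, Q ≠ P → x ∈ Q.localRing}
  mul_mem' ha hb Q hQ := mul_mem (ha Q hQ) (hb Q hQ)
  add_mem' ha hb Q hQ := add_mem (ha Q hQ) (hb Q hQ)
  algebraMap_mem' c Q _ := Q.algebraMap_mem c

variable [Fintype Fq]

/-- The norm `‖x‖ = q ^ (-v(x))` on `K`, with `v` the normalized valuation at the point `P`. -/
def abv (P : ClosedPoint Fq K) : AbsoluteValue K ℝ :=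
  (IsDiscreteValuationRing.maximalIdeal P.localRing).adicAbv (K := K)
    (b := (Fintype.card Fq : NNReal)) (by exact_mod_cast Fintype.one_lt_card)

theorem isNonarchimedean_abv (P : ClosedPoint Fq K) : IsNonarchimedean P.abv :=
  IsDedekindDomain.HeightOneSpectrum.isNonarchimedean_adicAbv _ _

/-- The completion `K_∞` of `K` at the point `P`. -/
abbrev KInf (P : ClosedPoint Fq K) : Type _ := P.abv.Completion

instance (P : ClosedPoint Fq K) : IsUltrametricDist (WithAbs P.abv) :=
  IsUltrametricDist.isUltrametricDist_of_forall_norm_add_le_max_norm fun x y =>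
    P.isNonarchimedean_abv x.ofAbs y.ofAbs

instance (P : ClosedPoint Fq K) : IsUltrametricDist P.KInf :=
  IsUltrametricDist.isUltrametricDist_of_forall_norm_add_le_max_norm fun x y => by
    induction x, y using UniformSpace.Completion.induction_on₂ with
    | hp => exact isClosed_le (by fun_prop) (by fun_prop)
    | ih x y =>
      rw [← UniformSpace.Completion.coe_add]
      simpa only [UniformSpace.Completion.norm_coe] using
        IsUltrametricDist.norm_add_le_max x y

instance (P : ClosedPoint Fq K) : NontriviallyNormedField P.KInf where
  non_trivial := by
    obtain ⟨π, hπ⟩ := IsDedekindDomain.HeightOneSpectrum.valuation_exists_uniformizer K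
      (IsDiscreteValuationRing.maximalIdeal P.localRing)
    have hlt : P.abv π < 1 := by
      have h1 : (1 : NNReal) < (Fintype.card Fq : NNReal) := by exact_mod_cast Fintype.one_lt_card
      have h2 := (WithZeroMulInt.toNNReal_lt_one_iff (m :=
        (IsDiscreteValuationRing.maximalIdeal P.localRing).valuation K π) h1).2 (by
          rw [hπ, ← WithZero.exp_zero, WithZero.exp_lt_exp]; norm_num)
      exact_mod_cast h2
    have hpos : 0 < P.abv π := P.abv.pos (by
      rintro rfl
      rw [map_zero] at hπ
      exact WithZero.exp_ne_zero hπ.symm)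
    refine ⟨((WithAbs.toAbs P.abv π⁻¹ : WithAbs P.abv) : P.KInf), ?_⟩
    rw [UniformSpace.Completion.norm_coe]
    change 1 < P.abv π⁻¹
    rw [map_inv₀]
    exact (one_lt_inv₀ hpos).2 hlt

/-- The algebraic closure of `K_∞`. -/
abbrev KInfAlg (P : ClosedPoint Fq K) : Type _ := AlgebraicClosure P.KInf

instance (P : ClosedPoint Fq K) : NontriviallyNormedField P.KInfAlg :=
  spectralNorm.nontriviallyNormedField P.KInf P.KInfAlg

/-- The field `ℂ_∞`: the completion of the algebraic closure of `K_∞` for the unique extension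
of the norm of `K_∞`. -/
def CInf (P : ClosedPoint Fq K) : Type _ := UniformSpace.Completion P.KInfAlg

instance (P : ClosedPoint Fq K) : NontriviallyNormedField P.CInf where
  __ := (inferInstance : NormedField (UniformSpace.Completion P.KInfAlg))
  non_trivial := by
    obtain ⟨x, hx⟩ := NontriviallyNormedField.non_trivial (α := P.KInfAlg)
    exact ⟨(x : UniformSpace.Completion P.KInfAlg), by
      simpa [UniformSpace.Completion.norm_coe] using! hx⟩

instance (P : ClosedPoint Fq K) : CompleteSpace P.CInf :=
  inferInstanceAs (CompleteSpace (UniformSpace.Completion P.KInfAlg))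

instance (P : ClosedPoint Fq K) : Algebra P.KInfAlg P.CInf :=
  inferInstanceAs (Algebra P.KInfAlg (UniformSpace.Completion P.KInfAlg))

/-- The embedding `K → K_∞ → ℂ_∞`. -/
def toCInf (P : ClosedPoint Fq K) : K →+* P.CInf :=
  (algebraMap P.KInfAlg P.CInf).comp <| (algebraMap P.KInf P.KInfAlg).comp <|
    (algebraMap (WithAbs P.abv) P.KInf).comp (WithAbs.equiv P.abv).symm.toRingHom

instance (P : ClosedPoint Fq K) : Algebra K P.CInf := P.toCInf.toAlgebra

instance (P : ClosedPoint Fq K) : Algebra Fq P.CInf :=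
  (P.toCInf.comp (algebraMap Fq K)).toAlgebra

instance (P : ClosedPoint Fq K) : IsScalarTower Fq K P.CInf :=
  IsScalarTower.of_algebraMap_eq fun _ => rfl

instance (P : ClosedPoint Fq K) : IsScalarTower Fq P.ringAway P.CInf :=
  IsScalarTower.of_algebraMap_eq fun _ => rfl

theorem pow_card_surjective (P : ClosedPoint Fq K) :
    Function.Surjective fun x : P.CInf => x ^ Fintype.card Fq := by
  intro c
  have hq : Fintype.card Fq ≠ 0 := Fintype.card_ne_zero
  have hdense : DenseRange (algebraMap P.KInfAlg P.CInf) :=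
    UniformSpace.Completion.denseRange_coe (α := P.KInfAlg)
  obtain ⟨u, hu, hlim⟩ := mem_closure_iff_seq_limit.1 (hdense c)
  have hroot (n : ℕ) : ∃ v : P.CInf, v ^ Fintype.card Fq = u n := by
    obtain ⟨w, hw⟩ := hu n
    obtain ⟨z, hz⟩ := IsAlgClosed.exists_pow_nat_eq w (Fintype.card_pos (α := Fq))
    exact ⟨algebraMap P.KInfAlg P.CInf z, by rw [← map_pow, hz, hw]⟩
  choose v hv using hroot
  have hdist (m n : ℕ) : dist (v m) (v n) ^ Fintype.card Fq = dist (u m) (u n) := by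
    rw [dist_eq_norm, dist_eq_norm, ← norm_pow, ← hv, ← hv]
    exact congrArg norm (map_sub (FiniteField.frobeniusAlgHom Fq P.CInf) (v m) (v n))
  have hcauchy : CauchySeq v := by
    rw [Metric.cauchySeq_iff']
    intro ε hε
    obtain ⟨N, hN⟩ := Metric.cauchySeq_iff'.1 hlim.cauchySeq (ε ^ Fintype.card Fq) (by positivity)
    refine ⟨N, fun n hn => lt_of_pow_lt_pow_left₀ (Fintype.card Fq) hε.le ?_⟩
    rw [hdist]
    exact hN n hn
  obtain ⟨x, hx⟩ := cauchySeq_tendsto_of_complete hcauchy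
  refine ⟨x, tendsto_nhds_unique (hx.pow (Fintype.card Fq)) ?_⟩
  simpa only [hv] using hlim

/-- The Frobenius automorphism `τ : x ↦ x ^ q` of `ℂ_∞`. -/
def frob (P : ClosedPoint Fq K) : P.CInf ≃+* P.CInf :=
  RingEquiv.ofBijective (FiniteField.frobeniusAlgHom Fq P.CInf)
    ⟨(FiniteField.frobeniusAlgHom Fq P.CInf).toRingHom.injective,
      P.pow_card_surjective⟩

end ClosedPoint

/-! ## Twisted power series -/

/-- Twisted power series `∑ aᵢ σⁱ` over a ring `R` with automorphism `σ`, where `σ ∘ a = σ(a) σ`.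
For `σ = τ` this is `R[[τ]]`, for `σ = τ⁻¹` it is `R[[τ⁻¹]]`. -/
@[ext]
structure TwistedSeries {R : Type*} [CommRing R] (σ : R ≃+* R) where
  coeff : ℕ → R

namespace TwistedSeries

variable {R : Type*} [CommRing R] {σ : R ≃+* R}

/-- The composition product: `(∑ aᵢ σⁱ) (∑ bⱼ σʲ) = ∑ aᵢ σⁱ(bⱼ) σⁱ⁺ʲ`. -/
instance : Mul (TwistedSeries σ) where
  mul F G := ⟨fun n => ∑ ij ∈ Finset.HasAntidiagonal.antidiagonal n, F.coeff ij.1 * σ^[ij.1] (G.coeff ij.2)⟩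

/-- The constant series `a`, that is, multiplication by `a`. -/
def const (a : R) : TwistedSeries σ := ⟨fun n => if n = 0 then a else 0⟩

/-- The series `1 - σ`. -/
def oneSub : TwistedSeries σ := ⟨fun n => if n = 0 then 1 else if n = 1 then -1 else 0⟩

/-- The adjoint `(∑ aᵢ σⁱ)^* = ∑ σ⁻ⁱ aᵢ = ∑ σ⁻ⁱ(aᵢ) σ⁻ⁱ`. -/
def adjoint (F : TwistedSeries σ) : TwistedSeries σ.symm := ⟨fun n => σ.symm^[n] (F.coeff n)⟩

/-- The series `∑ aᵢ σⁱ` converges at `x`, with value `y = ∑ aᵢ σⁱ(x)`. -/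
def HasEval [TopologicalSpace R] (F : TwistedSeries σ) (x y : R) : Prop :=
  HasSum (fun n => F.coeff n * σ^[n] x) y

/-- The value `∑ aᵢ σⁱ(x)`. -/
def eval [TopologicalSpace R] (F : TwistedSeries σ) (x : R) : R :=
  ∑' n, F.coeff n * σ^[n] x

theorem coeff_zero_mul_oneSub (F : TwistedSeries σ) :
    (F * oneSub).coeff 0 = F.coeff 0 := by
  change ∑ ij ∈ Finset.HasAntidiagonal.antidiagonal 0, _ = _
  simp [oneSub]

theorem coeff_succ_mul_oneSub (F : TwistedSeries σ) (n : ℕ) :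
    (F * oneSub).coeff (n + 1) = F.coeff (n + 1) - F.coeff n := by
  change ∑ ij ∈ Finset.HasAntidiagonal.antidiagonal (n + 1), _ = _
  rw [Finset.Nat.sum_antidiagonal_succ']
  cases n with
  | zero => simp [oneSub, sub_eq_add_neg]
  | succ n =>
    rw [Finset.Nat.sum_antidiagonal_succ']
    simp [oneSub, iterate_map_zero, iterate_map_one, iterate_map_neg, sub_eq_add_neg]

/-- Every series in `R[[σ⁻¹]]` is divisible on the right by `1 - σ⁻¹`, in a unique way. -/
theorem existsUnique_adjoint_mul_oneSub (H : TwistedSeries σ.symm) :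
    ∃! g : TwistedSeries σ, H = g.adjoint * oneSub := by
  have hl (n : ℕ) (x : R) : σ.symm^[n] (σ^[n] x) = x :=
    (Function.LeftInverse.iterate σ.symm_apply_apply n) x
  refine ⟨⟨fun n => σ^[n] (∑ i ∈ Finset.range (n + 1), H.coeff i)⟩, ?_, ?_⟩
  · ext n
    cases n with
    | zero => rw [coeff_zero_mul_oneSub]; simp [adjoint]
    | succ n =>
      rw [coeff_succ_mul_oneSub]
      simp only [adjoint, hl]
      rw [Finset.sum_range_succ _ (n + 1)]
      ring
  · intro g hg
    have key (n : ℕ) : g.adjoint.coeff n = ∑ i ∈ Finset.range (n + 1), H.coeff i := by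
      induction n with
      | zero => rw [hg, Finset.sum_range_one, coeff_zero_mul_oneSub]
      | succ n ih =>
        rw [Finset.sum_range_succ, ← ih, congrArg (fun F => F.coeff (n + 1)) hg]
        rw [coeff_succ_mul_oneSub]
        ring
    ext n
    have hinj : Function.Injective (σ.symm^[n]) := σ.symm.injective.iterate n
    apply hinj
    rw [hl]
    exact key n

end TwistedSeries

/-! ## The exponential of a lattice, its dual, and Poonen's series -/

namespace ClosedPoint

variable {Fq K : Type*} [Field Fq] [Field K] [Algebra Fq K] [Fintype Fq]
  {P : ClosedPoint Fq K}

open scoped PowerSeries.WithPiTopology in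
/-- The exponential `exp_Λ = x ∏_{λ ∈ Λ ∖ {0}} (1 - x / λ)` in `ℂ_∞[[x]]`; the infinite product
is taken coefficientwise. -/
def expPowerSeries (Λ : Submodule P.ringAway P.CInf) : PowerSeries P.CInf :=
  PowerSeries.X * ∏' l : {l : Λ // l ≠ 0},
    (1 - PowerSeries.C ((l : Λ) : P.CInf)⁻¹ * PowerSeries.X)

/-- The exponential as the element `∑ eᵢ τⁱ` of `ℂ_∞[[τ]]`, with `eᵢ` the coefficient of
`x ^ (q ^ i)`. -/
def expSeries (Λ : Submodule P.ringAway P.CInf) : TwistedSeries P.frob :=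
  ⟨fun i => PowerSeries.coeff (Fintype.card Fq ^ i) (expPowerSeries Λ)⟩

/-- The dual exponential `exp_Λ^* = ∑ τ⁻ⁱ eᵢ` in `ℂ_∞[[τ⁻¹]]`. -/
def dualExpSeries (Λ : Submodule P.ringAway P.CInf) : TwistedSeries P.frob.symm :=
  (expSeries Λ).adjoint

/-- The kernel of the dual exponential, in `ℂ_∞`. -/
def kerDualExp (Λ : Submodule P.ringAway P.CInf) : Set P.CInf :=
  {β | (dualExpSeries Λ).HasEval β 0}

theorem existsUnique_poonenSeries (Λ : Submodule P.ringAway P.CInf) (β : P.CInf) :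
    ∃! g : TwistedSeries P.frob,
      dualExpSeries Λ * TwistedSeries.const β = g.adjoint * TwistedSeries.oneSub :=
  TwistedSeries.existsUnique_adjoint_mul_oneSub _

/-- Poonen's series `g_β`: the unique `g` in `ℂ_∞[[τ]]` with `exp_Λ^* ∘ β = g^* ∘ (1 - τ⁻¹)`. -/
def poonenSeries (Λ : Submodule P.ringAway P.CInf) (β : P.CInf) : TwistedSeries P.frob :=
  (existsUnique_poonenSeries Λ β).choose

theorem poonenSeries_spec (Λ : Submodule P.ringAway P.CInf) (β : P.CInf) :
    dualExpSeries Λ * TwistedSeries.const β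
      = (poonenSeries Λ β).adjoint * TwistedSeries.oneSub :=
  (existsUnique_poonenSeries Λ β).choose_spec.1

end ClosedPoint

end

set_option linter.unusedSectionVars false

noncomputable section

open Polynomial Filter Topology
open scoped Classical

/-! ## Linearized polynomials -/

section Linearized

variable (Fq : Type*) {C : Type*} [Field Fq] [Fintype Fq] [Field C] [Algebra Fq C]

/-! Write `g` for Poonen's series of `β`. Its defining relation is the recursion `g_n = β e_n +
g_{n-1}^q`, that is `(1 - τ) g = β exp_Λ`, and `τ⁻ⁿ(g_n)` is the `n`-th partial sum of `exp_Λ^*(β)`.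
Hence `β` is in the kernel exactly when `‖g_n‖ r^(q^n)` is bounded in `n` for every `r`, i.e. when
`g` is entire (`mem_kerDualExp_iff`). Where `exp_Λ` vanishes this gives `g(λ) = g(λ)^q`, so `g`
restricts to a linear form on `Λ` with values in `Fq`.

To recover `β`, sum over the finite subspace `s` of lattice points of norm at most `r`. As `g_0 =
β`, the quantity `∑ g(λ)/λ + β` equals `∑_n g_n ∑_{λ ∈ s} λ^(q^n - 1)`. The vanishing polynomial of
`s` is linearized, so its derivative is a constant `p`, and the power sums of `s` have generating
series `p X^(|s|-1) / ∏ (1 - λX)`. With `T = r ∏ (r/‖λ‖)` this bounds the `k`-th power sum by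
`r^(k+1)/T` (`growth_mul_norm_powerSum_le`). The relation `g^q = g - β exp_Λ` bootstraps to `(‖g_n‖
r^(q^n))^q ≤ max(1, ‖β‖T)` (`poonenCoeff_bound`). Every term is then at most `max(1, ‖β‖T)^(1/q)/T`,
which tends to `0` because `T ≥ r` and `q ≥ 2`.

Conversely, a linear form `f` on a finite subspace `V` is interpolated by a multiple `h` of the
vanishing polynomial of `ker f`, with `h - h^q = h_1 exp_V` and `h_1 = -∑ f(λ)/λ`
(`exists_linearized_eq_on`). Its coefficients obey Poonen's recursion, and uniform bounds allow
passage to the limit as `V` exhausts `Λ`.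

Sums over `Λ` converge unconditionally because balls meet `Λ` in finite sets: `K_∞` is locally
compact, and `Λ` lies in a finite-dimensional space over it. -/

theorem add_pow_card_pow {R : Type*} [CommRing R] [Algebra Fq R] (x y : R) (i : ℕ) :
    (x + y) ^ Fintype.card Fq ^ i = x ^ Fintype.card Fq ^ i + y ^ Fintype.card Fq ^ i := by
  induction i with
  | zero => simp
  | succ i ih =>
    rw [pow_succ, pow_mul, ih, pow_mul, pow_mul]
    exact map_add (FiniteField.frobeniusAlgHom Fq R) _ _

theorem sub_pow_card_pow {R : Type*} [CommRing R] [Algebra Fq R] (x y : R) (i : ℕ) :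
    (x - y) ^ Fintype.card Fq ^ i = x ^ Fintype.card Fq ^ i - y ^ Fintype.card Fq ^ i := by
  rw [eq_sub_iff_add_eq, ← add_pow_card_pow, sub_add_cancel]

theorem smul_pow_card_pow {R : Type*} [CommRing R] [Algebra Fq R] (a : Fq) (x : R) (i : ℕ) :
    (a • x) ^ Fintype.card Fq ^ i = a • x ^ Fintype.card Fq ^ i := by
  rw [_root_.smul_pow, FiniteField.pow_card_pow]

theorem card_cast_eq_zero : (Fintype.card Fq : C) = 0 := by
  have h : ((Fintype.card Fq : Fq) : Fq) = 0 := FiniteField.cast_card_eq_zero Fq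
  rw [← map_natCast (algebraMap Fq C), h, map_zero]

/-- The polynomials `∑ aᵢ X ^ (q ^ i)`. -/
def linearized (C : Type*) [Field C] : Submodule C C[X] :=
  Submodule.span C (Set.range fun i : ℕ => (X ^ Fintype.card Fq ^ i : C[X]))

variable {Fq}

theorem linearized_induction {p : C[X] → Prop} (hX : ∀ i, p (X ^ Fintype.card Fq ^ i))
    (h0 : p 0) (hadd : ∀ P Q, p P → p Q → p (P + Q)) (hsmul : ∀ (c : C) P, p P → p (c • P))
    {P : C[X]} (hP : P ∈ linearized Fq C) : p P := by
  refine Submodule.span_induction (p := fun P _ => p P) ?_ h0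
    (fun P Q _ _ => hadd P Q) (fun c P _ => hsmul c P) hP
  rintro _ ⟨i, rfl⟩
  exact hX i

theorem X_mem_linearized : (X : C[X]) ∈ linearized Fq C :=
  Submodule.subset_span ⟨0, by simp⟩

theorem pow_card_mem_linearized {P : C[X]} (hP : P ∈ linearized Fq C) :
    P ^ Fintype.card Fq ∈ linearized Fq C := by
  refine linearized_induction (Fq := Fq) (p := fun P => P ^ Fintype.card Fq ∈ linearized Fq C)
    (fun i => ?_) ?_ (fun P Q hP hQ => ?_) (fun c P hP => ?_) hP
  · exact Submodule.subset_span ⟨i + 1, by simp only [pow_succ, pow_mul]⟩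
  · rw [zero_pow Fintype.card_ne_zero]
    exact zero_mem _
  · have h := add_pow_card_pow Fq P Q 1
    rw [pow_one] at h
    rw [h]
    exact add_mem hP hQ
  · rw [_root_.smul_pow]
    exact Submodule.smul_mem _ _ hP

/-- Additivity as an identity of polynomials, which lets the vanishing polynomial of a coset be read
off from that of the subspace. -/
theorem comp_X_sub_C_of_mem_linearized {P : C[X]} (hP : P ∈ linearized Fq C) (v : C) :
    P.comp (X - Polynomial.C v) = P - Polynomial.C (P.eval v) := by
  refine linearized_induction (Fq := Fq)
    (p := fun P => P.comp (X - Polynomial.C v) = P - Polynomial.C (P.eval v))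
    (fun i => ?_) ?_ (fun P Q hP hQ => ?_) (fun c P hP => ?_) hP
  · rw [X_pow_comp, sub_pow_card_pow, eval_pow, eval_X, map_pow]
  · simp
  · rw [add_comp, hP, hQ, eval_add, map_add]
    ring
  · rw [smul_comp, hP, eval_smul, smul_sub, smul_C]

theorem eval_add_of_mem_linearized {P : C[X]} (hP : P ∈ linearized Fq C) (x y : C) :
    P.eval (x + y) = P.eval x + P.eval y := by
  have h := congrArg (eval (x + y)) (comp_X_sub_C_of_mem_linearized hP y)
  simp only [eval_comp, eval_sub, eval_X, eval_C, add_sub_cancel_right] at h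
  rw [h]
  ring

theorem eval_smul_of_mem_linearized {P : C[X]} (hP : P ∈ linearized Fq C) (a : Fq) (x : C) :
    P.eval (a • x) = a • P.eval x := by
  refine linearized_induction (Fq := Fq)
    (p := fun P => P.eval (a • x) = a • P.eval x)
    (fun i => ?_) ?_ (fun P Q hP hQ => ?_) (fun c P hP => ?_) hP
  · rw [eval_pow, eval_X, eval_pow, eval_X, smul_pow_card_pow]
  · simp
  · rw [eval_add, eval_add, hP, hQ, smul_add]
  · rw [eval_smul, eval_smul, hP, smul_comm]

theorem coeff_of_mem_linearized {P : C[X]} (hP : P ∈ linearized Fq C) {k : ℕ}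
    (hk : ∀ i, k ≠ Fintype.card Fq ^ i) : P.coeff k = 0 := by
  refine linearized_induction (Fq := Fq) (p := fun P => P.coeff k = 0)
    (fun i => ?_) ?_ (fun P Q hP hQ => ?_) (fun c P hP => ?_) hP
  · rw [coeff_X_pow, if_neg (hk i)]
  · simp
  · rw [coeff_add, hP, hQ, add_zero]
  · rw [coeff_smul, hP, smul_zero]

/-- The exponents `q ^ i` with `i > 0` are zero in `C`. -/
theorem derivative_of_mem_linearized {P : C[X]} (hP : P ∈ linearized Fq C) :
    derivative P = Polynomial.C (P.coeff 1) := by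
  refine linearized_induction (Fq := Fq) (p := fun P => derivative P = Polynomial.C (P.coeff 1))
    (fun i => ?_) ?_ (fun P Q hP hQ => ?_) (fun c P hP => ?_) hP
  · cases i with
    | zero => simp
    | succ i =>
      have h1 : (1 : ℕ) ≠ Fintype.card Fq ^ (i + 1) :=
        (Nat.one_lt_pow i.succ_ne_zero Fintype.one_lt_card).ne
      rw [derivative_X_pow, coeff_X_pow, if_neg h1, Nat.cast_pow, card_cast_eq_zero Fq,
        zero_pow i.succ_ne_zero]
      simp
  · simp
  · rw [derivative_add, hP, hQ, coeff_add, map_add]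
  · rw [derivative_smul, hP, coeff_smul, smul_C]

theorem coeff_succ_pow_card_of_mem_linearized {P : C[X]} (hP : P ∈ linearized Fq C) (i : ℕ) :
    (P ^ Fintype.card Fq).coeff (Fintype.card Fq ^ (i + 1)) =
      P.coeff (Fintype.card Fq ^ i) ^ Fintype.card Fq := by
  have hq0 : Fintype.card Fq ≠ 0 := Fintype.card_ne_zero
  refine linearized_induction (Fq := Fq) (p := fun P =>
    (P ^ Fintype.card Fq).coeff (Fintype.card Fq ^ (i + 1)) =
      P.coeff (Fintype.card Fq ^ i) ^ Fintype.card Fq)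
    (fun j => ?_) ?_ (fun P Q hP hQ => ?_) (fun c P hP => ?_) hP
  · rw [← pow_mul, ← pow_succ, coeff_X_pow, coeff_X_pow]
    have hinj := Nat.pow_right_injective (Fintype.one_lt_card (α := Fq))
    by_cases h : i = j
    · simp [h]
    · rw [if_neg fun h' => h (by simpa using hinj h'), if_neg fun h' => h (hinj h'), zero_pow hq0]
  · simp [zero_pow hq0]
  · have h := add_pow_card_pow Fq P Q 1
    have h' := add_pow_card_pow Fq (P.coeff (Fintype.card Fq ^ i)) (Q.coeff (Fintype.card Fq ^ i)) 1
    rw [pow_one] at h h'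
    rw [h, coeff_add, coeff_add, hP, hQ, h']
  · rw [_root_.smul_pow, coeff_smul, coeff_smul, hP, _root_.smul_pow]

theorem coeff_one_pow_card_of_mem_linearized {P : C[X]} (hP : P ∈ linearized Fq C) :
    (P ^ Fintype.card Fq).coeff 1 = 0 := by
  have hq0 : Fintype.card Fq ≠ 0 := Fintype.card_ne_zero
  refine linearized_induction (Fq := Fq) (p := fun P => (P ^ Fintype.card Fq).coeff 1 = 0)
    (fun j => ?_) ?_ (fun P Q hP hQ => ?_) (fun c P hP => ?_) hP
  · rw [← pow_mul, ← pow_succ, coeff_X_pow, if_neg]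
    exact (Nat.one_lt_pow j.succ_ne_zero Fintype.one_lt_card).ne
  · simp [zero_pow hq0]
  · have h := add_pow_card_pow Fq P Q 1
    rw [pow_one] at h
    rw [h, coeff_add, hP, hQ, add_zero]
  · rw [_root_.smul_pow, coeff_smul, hP, smul_zero]

theorem sum_coeff_of_mem_linearized {P : C[X]} (hP : P ∈ linearized Fq C) {d : ℕ}
    (hd : P.natDegree < Fintype.card Fq ^ d) (x : C) :
    P.eval x = ∑ i ∈ Finset.range d,
      P.coeff (Fintype.card Fq ^ i) * x ^ Fintype.card Fq ^ i := by
  have hinj := Nat.pow_right_injective (Fintype.one_lt_card (α := Fq))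
  rw [eval_eq_sum_range' hd, ← Finset.sum_image (s := Finset.range d)
    (g := fun i => Fintype.card Fq ^ i) (f := fun k => P.coeff k * x ^ k) hinj.injOn]
  refine (Finset.sum_subset ?_ ?_).symm
  · intro k hk
    obtain ⟨i, hi, rfl⟩ := Finset.mem_image.1 hk
    exact Finset.mem_range.2 (Nat.pow_lt_pow_right Fintype.one_lt_card (Finset.mem_range.1 hi))
  · intro k hk hk'
    rw [coeff_of_mem_linearized hP, zero_mul]
    rintro i rfl
    refine hk' (Finset.mem_image_of_mem _ (Finset.mem_range.2 ?_))
    exact (Nat.pow_lt_pow_iff_right Fintype.one_lt_card).1 (Finset.mem_range.1 hk)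

theorem X_pow_card_sub_X_eq_prod :
    (X ^ Fintype.card Fq - X : Fq[X]) = ∏ a : Fq, (X - Polynomial.C a) := by
  have hdeg := FiniteField.X_pow_card_sub_X_natDegree_eq Fq (Fintype.one_lt_card (α := Fq))
  have hmon : (X ^ Fintype.card Fq - X : Fq[X]).Monic :=
    monic_X_pow_sub (by rw [degree_X]; exact_mod_cast Fintype.one_lt_card)
  have h := prod_multiset_X_sub_C_of_monic_of_roots_card_eq hmon (by
    rw [FiniteField.roots_X_pow_card_sub_X, hdeg]; rfl)
  rw [FiniteField.roots_X_pow_card_sub_X] at h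
  exact h.symm

theorem prod_sub_algebraMap {R : Type*} [CommRing R] [Algebra Fq R] (y : R) :
    ∏ a : Fq, (y - algebraMap Fq R a) = y ^ Fintype.card Fq - y := by
  have h := congrArg (aeval y) (X_pow_card_sub_X_eq_prod (Fq := Fq))
  rw [map_prod] at h
  simpa using h.symm

theorem exists_algebraMap_eq_of_pow_card_eq {y : C} (hy : y ^ Fintype.card Fq = y) :
    ∃ a : Fq, algebraMap Fq C a = y := by
  have h := prod_sub_algebraMap (Fq := Fq) y
  rw [hy, sub_self, Finset.prod_eq_zero_iff] at h
  obtain ⟨a, -, ha⟩ := h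
  exact ⟨a, (sub_eq_zero.1 ha).symm⟩

/-- The identity `∏ (y - a) = y^q - y` at `y = P / c`, scaled by `c^q`. -/
theorem prod_sub_smul_C (P : C[X]) (c : C) (hc : c ≠ 0) :
    ∏ a : Fq, (P - Polynomial.C (a • c)) =
      P ^ Fintype.card Fq - Polynomial.C (c ^ (Fintype.card Fq - 1)) * P := by
  have h := prod_sub_algebraMap (Fq := Fq) (Polynomial.C c⁻¹ * P)
  have hcc : Polynomial.C c * Polynomial.C c⁻¹ = 1 := by
    rw [← map_mul, mul_inv_cancel₀ hc, map_one]
  have h1 (a : Fq) : P - Polynomial.C (a • c) =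
      Polynomial.C c * (Polynomial.C c⁻¹ * P - algebraMap Fq C[X] a) := by
    rw [mul_sub, ← mul_assoc, hcc, one_mul, Algebra.smul_def, mul_comm, map_mul]
    rfl
  have hq : Polynomial.C c ^ Fintype.card Fq = Polynomial.C c ^ (Fintype.card Fq - 1) *
      Polynomial.C c := by
    rw [← pow_succ, Nat.sub_add_cancel Fintype.card_pos]
  simp_rw [h1]
  rw [Finset.prod_mul_distrib, h, Finset.prod_const, Finset.card_univ, mul_sub, ← mul_pow,
    ← mul_assoc, hcc, one_mul, hq, mul_assoc, ← mul_assoc (Polynomial.C c), hcc, one_mul, map_pow]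

/-- The monic polynomial with the elements of `s` as roots. -/
def vanishing (s : Finset C) : C[X] := ∏ l ∈ s, (X - Polynomial.C l)

/-- Group the roots by the cosets `W + a v`: with `Q` the polynomial of `W`, each coset contributes
`Q(X - a v) = Q - a Q(v)`, and the product over `a` is `prod_sub_smul_C`. -/
theorem vanishing_sum_smul {W : Submodule Fq C} {t s : Finset C} (ht : (t : Set C) = W) {v : C}
    (hv : v ∉ W) (hs : ∀ x, x ∈ s ↔ ∃ w ∈ W, ∃ a : Fq, w + a • v = x)
    (hlin : vanishing t ∈ linearized Fq C) :
    s.card = Fintype.card Fq * t.card ∧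
    vanishing s = vanishing t ^ Fintype.card Fq -
      Polynomial.C ((vanishing t).eval v ^ (Fintype.card Fq - 1)) * vanishing t := by
  classical
  have hmem (x : C) : x ∈ t ↔ x ∈ W := by rw [← Finset.mem_coe, ht]; rfl
  have hc : (vanishing t).eval v ≠ 0 := by
    rw [vanishing, eval_prod, Finset.prod_ne_zero_iff]
    intro w hw h
    rw [eval_sub, eval_X, eval_C, sub_eq_zero] at h
    exact hv (h ▸ (hmem w).1 hw)
  have hinj : Set.InjOn (fun x : Fq × C => x.2 + x.1 • v) ↑(Finset.univ ×ˢ t : Finset (Fq × C)) := by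
    rintro ⟨a, w⟩ hw ⟨b, u⟩ hu h
    have hw' : w ∈ W := (hmem w).1 (by simpa using hw)
    have hu' : u ∈ W := (hmem u).1 (by simpa using hu)
    have hab : a = b := by
      by_contra hab
      refine hv ?_
      have : (a - b) • v = u - w := by
        rw [sub_smul, sub_eq_sub_iff_add_eq_add, add_comm, add_comm u]
        exact h.trans (add_comm _ _)
      rw [← inv_smul_smul₀ (sub_ne_zero.2 hab) v, this]
      exact W.smul_mem _ (W.sub_mem hu' hw')
    subst hab
    simpa using h
  have hs' : s = (Finset.univ ×ˢ t : Finset (Fq × C)).image fun x => x.2 + x.1 • v := by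
    ext x
    rw [hs, Finset.mem_image]
    constructor
    · rintro ⟨w, hw, a, rfl⟩
      exact ⟨(a, w), by simpa using (hmem w).2 hw, rfl⟩
    · rintro ⟨⟨a, w⟩, hw, rfl⟩
      exact ⟨w, (hmem w).1 (by simpa using hw), a, rfl⟩
  constructor
  · rw [hs', Finset.card_image_of_injOn hinj, Finset.card_product, Finset.card_univ]
  · rw [← prod_sub_smul_C _ _ hc, vanishing, hs', Finset.prod_image hinj, Finset.prod_product]
    refine Finset.prod_congr rfl fun a _ => ?_
    rw [← eval_smul_of_mem_linearized hlin, ← comp_X_sub_C_of_mem_linearized hlin, vanishing,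
      prod_comp]
    refine Finset.prod_congr rfl fun w _ => ?_
    rw [sub_comp, X_comp, C_comp, map_add]
    ring

theorem vanishing_mem_linearized {V : Submodule Fq C} {s : Finset C} (hs : (s : Set C) = V) :
    vanishing s ∈ linearized Fq C := by
  classical
  -- Induct on a finite spanning set; the subspace spans itself.
  suffices H : ∀ (t s : Finset C), (s : Set C) = Submodule.span Fq (t : Set C) →
      vanishing s ∈ linearized Fq C from H s s (by rw [hs, Submodule.span_eq])
  intro t
  induction t using Finset.induction_on with
  | empty =>
    intro s hs
    rw [Finset.coe_empty, Submodule.span_empty, Submodule.bot_coe, Finset.coe_eq_singleton] at hs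
    rw [hs, vanishing, Finset.prod_singleton, map_zero, sub_zero]
    exact X_mem_linearized
  | insert v t _ ih =>
    intro s hs
    by_cases hv : v ∈ Submodule.span Fq (t : Set C)
    · refine ih s ?_
      rw [hs, Finset.coe_insert, Submodule.span_insert_eq_span hv]
    · have hsub : (Submodule.span Fq (t : Set C) : Set C) ⊆ s := by
        rw [hs]
        exact Submodule.span_mono (by simp)
      have hfin := s.finite_toSet.subset hsub
      have ht := hfin.coe_toFinset
      have hlin := ih _ ht
      rw [(vanishing_sum_smul ht hv (fun x => ?_) hlin).2]
      · refine sub_mem (pow_card_mem_linearized hlin) ?_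
        rw [← smul_eq_C_mul]
        exact Submodule.smul_mem _ _ hlin
      · rw [← Finset.mem_coe, hs, Finset.coe_insert, SetLike.mem_coe, Submodule.mem_span_insert]
        constructor
        · rintro ⟨a, z, hz, rfl⟩
          exact ⟨z, hz, a, add_comm _ _⟩
        · rintro ⟨z, hz, a, rfl⟩
          exact ⟨a, z, hz, add_comm _ _⟩

end Linearized

/-! ## Power sums and linear forms on finite subspaces -/

section PowerSums

variable {C : Type*} [Field C]

/-- The polynomial `X ∏ (1 - X / l)`, the product over the nonzero `l` in `s`. -/
def expPoly (s : Finset C) : C[X] := X * ∏ l ∈ s.erase 0, (1 - Polynomial.C l⁻¹ * X)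

theorem vanishing_eq_C_mul_expPoly {s : Finset C} (h0 : 0 ∈ s) :
    vanishing s = Polynomial.C (∏ l ∈ s.erase 0, -l) * expPoly s := by
  rw [vanishing, ← Finset.mul_prod_erase s _ h0, map_zero, sub_zero, expPoly, map_prod,
    mul_left_comm, ← Finset.prod_mul_distrib]
  congr 1
  refine Finset.prod_congr rfl fun l hl => ?_
  have : Polynomial.C l * Polynomial.C l⁻¹ = 1 := by
    rw [← map_mul, mul_inv_cancel₀ (Finset.ne_of_mem_erase hl), map_one]
  rw [map_neg]
  linear_combination (-X : C[X]) * this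

theorem coeff_one_expPoly (s : Finset C) : (expPoly s).coeff 1 = 1 := by
  rw [expPoly, coeff_X_mul, coeff_zero_eq_eval_zero, eval_prod]
  simp

theorem coeff_one_vanishing {s : Finset C} (h0 : 0 ∈ s) :
    (vanishing s).coeff 1 = ∏ l ∈ s.erase 0, -l := by
  rw [vanishing_eq_C_mul_expPoly h0, coeff_C_mul, coeff_one_expPoly, mul_one]

theorem prod_erase_neg_ne_zero (s : Finset C) : ∏ l ∈ s.erase 0, -l ≠ 0 :=
  Finset.prod_ne_zero_iff.2 fun _ hl => neg_ne_zero.2 (Finset.ne_of_mem_erase hl)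

theorem expPoly_eq_smul_vanishing {s : Finset C} (h0 : 0 ∈ s) :
    expPoly s = (∏ l ∈ s.erase 0, -l)⁻¹ • vanishing s := by
  rw [vanishing_eq_C_mul_expPoly h0, ← smul_eq_C_mul, inv_smul_smul₀ (prod_erase_neg_ne_zero s)]

theorem mk_pow_mul_one_sub (l : C) :
    (PowerSeries.mk fun k => l ^ k) * (1 - PowerSeries.C l * PowerSeries.X) = 1 := by
  ext k
  rw [mul_sub, mul_one, mul_left_comm, map_sub, PowerSeries.coeff_C_mul]
  cases k with
  | zero => simp
  | succ k => simp [PowerSeries.coeff_succ_mul_X, PowerSeries.coeff_one, pow_succ']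

/-- The derivative of `∏ (X - l)` is `∑_l ∏_{m ≠ l} (X - m)`; replacing `X` by `1/X` and clearing
denominators reverses each product. -/
theorem sum_prod_erase_one_sub [Infinite C] {s : Finset C} {p : C}
    (hs : derivative (vanishing s) = Polynomial.C p) :
    ∑ l ∈ s, ∏ m ∈ s.erase l, (1 - Polynomial.C m * X) = Polynomial.C p * X ^ (s.card - 1) := by
  -- The extra factor `X` disposes of the point `0`, so that evaluation at `x⁻¹` makes sense
  -- elsewhere.
  refine mul_left_cancel₀ (X_ne_zero (R := C)) (Polynomial.funext fun x => ?_)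
  by_cases hx : x = 0
  · simp [hx]
  have h := congrArg (eval x⁻¹) hs
  rw [vanishing, derivative_prod_finset, eval_finsetSum, eval_C] at h
  rw [eval_mul, eval_mul, eval_mul, eval_finsetSum, ← h, eval_X, eval_pow, eval_X, eval_C,
    Finset.sum_mul]
  congr 1
  refine Finset.sum_congr rfl fun l hl => ?_
  rw [eval_prod, eval_mul, eval_prod, derivative_X_sub_C, eval_one, mul_one,
    ← Finset.card_erase_of_mem hl, ← Finset.prod_const, ← Finset.prod_mul_distrib]
  refine Finset.prod_congr rfl fun m _ => ?_
  simp only [eval_sub, eval_one, eval_mul, eval_C, eval_X]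
  field_simp

/-- The left side is `∑ 1/(1 - lX)`; over the common denominator its numerator is
`sum_prod_erase_one_sub`. -/
theorem mk_powerSum [Infinite C] {s : Finset C} {p : C}
    (hs : derivative (vanishing s) = Polynomial.C p) :
    (PowerSeries.mk fun k => ∑ l ∈ s, l ^ k) =
      PowerSeries.C p * PowerSeries.X ^ (s.card - 1) * ∏ l ∈ s, PowerSeries.mk fun k => l ^ k := by
  have h := congrArg (Polynomial.coeToPowerSeries.ringHom (R := C)) (sum_prod_erase_one_sub hs)
  simp only [map_sum, map_prod, map_sub, map_mul, map_one, map_pow,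
    coeToPowerSeries.ringHom_apply, coe_C, coe_X] at h
  rw [← h, Finset.sum_mul]
  have h1 : (PowerSeries.mk fun k => ∑ l ∈ s, l ^ k) = ∑ l ∈ s, PowerSeries.mk fun k => l ^ k := by
    ext k
    simp [map_sum]
  rw [h1]
  refine Finset.sum_congr rfl fun l hl => ?_
  rw [← Finset.mul_prod_erase s _ hl, mul_left_comm, ← Finset.prod_mul_distrib,
    Finset.prod_eq_one, mul_one]
  intro m _
  rw [mul_comm, mk_pow_mul_one_sub]

theorem powerSum_eq_zero [Infinite C] {s : Finset C} {p : C}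
    (hs : derivative (vanishing s) = Polynomial.C p) {k : ℕ} (hk : k < s.card - 1) :
    ∑ l ∈ s, l ^ k = 0 := by
  have h := congrArg (PowerSeries.coeff k) (mk_powerSum hs)
  rwa [PowerSeries.coeff_mk, mul_assoc, PowerSeries.coeff_C_mul, PowerSeries.coeff_X_pow_mul',
    if_neg hk.not_ge, mul_zero] at h

/-- Restoring `l = 0` to the sum matters only for `n = 1`, since `0 ^ 0 = 1`. -/
theorem sum_erase_pow_div {s : Finset C} (h0 : 0 ∈ s) {n : ℕ} (hn : 0 < n) :
    ∑ l ∈ s.erase 0, l ^ n / l = ∑ l ∈ s, l ^ (n - 1) - if n = 1 then 1 else 0 := by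
  rw [← Finset.add_sum_erase s _ h0]
  have h : ∑ l ∈ s.erase 0, l ^ n / l = ∑ l ∈ s.erase 0, l ^ (n - 1) := by
    refine Finset.sum_congr rfl fun l hl => ?_
    rw [div_eq_iff (Finset.ne_of_mem_erase hl), ← pow_succ, Nat.sub_add_cancel hn]
  rw [h]
  split_ifs with h1
  · simp [h1]
  · rw [zero_pow (by omega)]
    ring

variable {Fq : Type*} [Field Fq] [Fintype Fq] [Algebra Fq C]

theorem derivative_vanishing {V : Submodule Fq C} {s : Finset C} (hs : (s : Set C) = V) :
    derivative (vanishing s) = Polynomial.C (∏ l ∈ s.erase 0, -l) := by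
  have h0 : (0 : C) ∈ s := by rw [← Finset.mem_coe, hs]; exact V.zero_mem
  rw [derivative_of_mem_linearized (vanishing_mem_linearized hs), coeff_one_vanishing h0]

theorem expPoly_mem_linearized {V : Submodule Fq C} {s : Finset C} (hs : (s : Set C) = V) :
    expPoly s ∈ linearized Fq C := by
  have h0 : (0 : C) ∈ s := by rw [← Finset.mem_coe, hs]; exact V.zero_mem
  rw [expPoly_eq_smul_vanishing h0]
  exact Submodule.smul_mem _ _ (vanishing_mem_linearized hs)

theorem eval_expPoly {s : Finset C} {l : C} (hl : l ∈ s) : (expPoly s).eval l = 0 := by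
  by_cases h : l = 0
  · simp [expPoly, h]
  · rw [expPoly, eval_mul, eval_prod, Finset.prod_eq_zero (Finset.mem_erase.2 ⟨h, hl⟩), mul_zero]
    simp [h]

/-- Expanding `h` gives power sums of exponents `q^i - 1 < |s| - 1`, all zero; what survives is the
correction `-1` at `i = 0`. -/
theorem coeff_one_of_natDegree_lt [Infinite C] {V : Submodule Fq C} {s : Finset C}
    (hs : (s : Set C) = V) {h : C[X]} (hh : h ∈ linearized Fq C) (hdeg : h.natDegree < s.card) :
    h.coeff 1 = -∑ l ∈ s.erase 0, h.eval l / l := by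
  have h0 : (0 : C) ∈ s := by rw [← Finset.mem_coe, hs]; exact V.zero_mem
  have hd : h.natDegree < Fintype.card Fq ^ (h.natDegree + 1) :=
    (Nat.lt_succ_self _).trans (Nat.lt_pow_self Fintype.one_lt_card)
  simp_rw [sum_coeff_of_mem_linearized hh hd, Finset.sum_div, mul_div_assoc]
  rw [Finset.sum_comm]
  simp_rw [← Finset.mul_sum]
  rw [Finset.sum_range_succ', Finset.sum_eq_zero]
  · rw [pow_zero, sum_erase_pow_div h0 one_pos]
    by_cases hN : h.natDegree = 0
    · simp [coeff_eq_zero_of_natDegree_lt (show h.natDegree < 1 by omega)]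
    · rw [powerSum_eq_zero (derivative_vanishing hs) (by omega)]
      simp
  · intro i _
    have hi : 1 < Fintype.card Fq ^ (i + 1) := Nat.one_lt_pow i.succ_ne_zero Fintype.one_lt_card
    rw [sum_erase_pow_div h0 (by omega), if_neg (by omega), sub_zero]
    by_cases hN : h.natDegree < Fintype.card Fq ^ (i + 1)
    · rw [coeff_eq_zero_of_natDegree_lt hN, zero_mul]
    · rw [powerSum_eq_zero (derivative_vanishing hs) (by omega), mul_zero]

/-- Take `h = Q / Q(v)` with `Q` the vanishing polynomial of `ker f` and `f v = 1`. By
`vanishing_sum_smul`, `h - h^q` is a multiple of the vanishing polynomial of `V`; comparing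
coefficients of `X` identifies the factor. -/
theorem exists_linearized_eq_on [Infinite C] {V : Submodule Fq C} {s : Finset C}
    (hs : (s : Set C) = V) (f : V →ₗ[Fq] Fq) :
    ∃ h ∈ linearized Fq C, (∀ l : V, h.eval (l : C) = algebraMap Fq C (f l)) ∧
      h - h ^ Fintype.card Fq = Polynomial.C (h.coeff 1) * expPoly s ∧
      h.coeff 1 = -∑ l ∈ s.erase 0, h.eval l / l := by
  have hq0 : Fintype.card Fq ≠ 0 := Fintype.card_ne_zero
  have h0 : (0 : C) ∈ s := by rw [← Finset.mem_coe, hs]; exact V.zero_mem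
  by_cases hf : f = 0
  · exact ⟨0, zero_mem _, by simp [hf], by simp [zero_pow hq0], by simp⟩
  obtain ⟨v, hv⟩ : ∃ v, f v = 1 := by
    obtain ⟨u, hu⟩ : ∃ u, f u ≠ 0 := by
      by_contra! H
      exact hf (LinearMap.ext H)
    exact ⟨(f u)⁻¹ • u, by rw [map_smul, smul_eq_mul, inv_mul_cancel₀ hu]⟩
  let W : Submodule Fq C := (LinearMap.ker f).map V.subtype
  have hWs : (W : Set C) ⊆ s := by
    rw [hs]
    rintro _ ⟨w, -, rfl⟩
    exact w.2
  have ht := (s.finite_toSet.subset hWs).coe_toFinset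
  set t := (s.finite_toSet.subset hWs).toFinset
  have hvW : (v : C) ∉ W := by
    rintro ⟨w, hw, hwv⟩
    have : w = v := Subtype.ext hwv
    rw [SetLike.mem_coe, LinearMap.mem_ker, this, hv] at hw
    exact one_ne_zero hw
  have hmemt (x : C) : x ∈ t ↔ x ∈ W := by rw [← Finset.mem_coe, ht]; rfl
  have hdec (l : V) : (l : C) - f l • (v : C) ∈ W := by
    refine ⟨l - f l • v, ?_, rfl⟩
    rw [SetLike.mem_coe, LinearMap.mem_ker, map_sub, map_smul, hv, smul_eq_mul, mul_one, sub_self]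
  have hlin := vanishing_mem_linearized ht
  have hVW := vanishing_sum_smul (s := s) ht hvW (fun x => by
    rw [← Finset.mem_coe, hs]
    constructor
    · exact fun hx => ⟨_, hdec ⟨x, hx⟩, f ⟨x, hx⟩, sub_add_cancel _ _⟩
    · rintro ⟨_, ⟨w, -, rfl⟩, a, rfl⟩
      exact V.add_mem w.2 (V.smul_mem a v.2)) hlin
  set Q := vanishing t
  set c := Q.eval (v : C)
  have hroot {w : C} (hw : w ∈ W) : Q.eval w = 0 := by
    change (vanishing t).eval w = 0
    rw [vanishing, eval_prod, Finset.prod_eq_zero ((hmemt w).2 hw)]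
    simp
  have hc : c ≠ 0 := by
    change (vanishing t).eval _ ≠ 0
    rw [vanishing, eval_prod, Finset.prod_ne_zero_iff]
    intro w hw h
    rw [eval_sub, eval_X, eval_C, sub_eq_zero] at h
    exact hvW (h ▸ (hmemt w).1 hw)
  have hh : c⁻¹ • Q ∈ linearized Fq C := Submodule.smul_mem _ _ hlin
  have hcq : c ^ (Fintype.card Fq - 1) = c ^ Fintype.card Fq * c⁻¹ := by
    rw [eq_mul_inv_iff_mul_eq₀ hc, ← pow_succ, Nat.sub_add_cancel Fintype.card_pos]
  have key : c⁻¹ • Q - (c⁻¹ • Q) ^ Fintype.card Fq =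
      Polynomial.C (-(c⁻¹ ^ Fintype.card Fq) * ∏ l ∈ s.erase 0, -l) * expPoly s := by
    rw [map_mul, mul_assoc, ← vanishing_eq_C_mul_expPoly h0, hVW.2, _root_.smul_pow, map_neg,
      ← sub_eq_zero, smul_eq_C_mul, smul_eq_C_mul, hcq, map_mul, inv_pow]
    have : Polynomial.C (c ^ Fintype.card Fq)⁻¹ * Polynomial.C (c ^ Fintype.card Fq) = 1 := by
      rw [← map_mul, inv_mul_cancel₀ (pow_ne_zero _ hc), map_one]
    linear_combination (-Polynomial.C c⁻¹ * Q) * this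
  refine ⟨c⁻¹ • Q, hh, fun l => ?_, ?_, coeff_one_of_natDegree_lt hs hh ?_⟩
  · have h1 := eval_add_of_mem_linearized hlin ((l : C) - f l • (v : C)) (f l • (v : C))
    rw [sub_add_cancel, hroot (hdec l), zero_add, eval_smul_of_mem_linearized hlin] at h1
    rw [eval_smul, h1, smul_eq_mul, Algebra.smul_def, mul_comm, mul_assoc, mul_inv_cancel₀ hc,
      mul_one]
  · have h1 := congrArg (fun F => coeff F 1) key
    simp only [coeff_sub, coeff_one_pow_card_of_mem_linearized hh, sub_zero, coeff_C_mul,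
      coeff_one_expPoly, mul_one] at h1
    rw [key, ← h1]
  · have h1 : Q.natDegree = t.card := by
      change (vanishing t).natDegree = _
      rw [vanishing, natDegree_prod_of_monic _ _ fun l _ => monic_X_sub_C l]
      simp
    have h2 : 0 < t.card := Finset.card_pos.2 ⟨0, (hmemt 0).2 W.zero_mem⟩
    have h3 := Fintype.one_lt_card (α := Fq)
    have h4 := natDegree_smul_le c⁻¹ Q
    rw [hVW.1]
    nlinarith

end PowerSums

/-! ## Ultrametric estimates for coefficients -/

section GaussBound

variable {C : Type*} [NontriviallyNormedField C] [IsUltrametricDist C]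

/-- Submultiplicativity of the Gauss norm of radius `r`. -/
theorem norm_coeff_mul_le {r A B : ℝ} (hr : 0 ≤ r) {F G : PowerSeries C}
    (hF : ∀ j, ‖PowerSeries.coeff j F‖ * r ^ j ≤ A) (hG : ∀ j, ‖PowerSeries.coeff j G‖ * r ^ j ≤ B)
    (j : ℕ) : ‖PowerSeries.coeff j (F * G)‖ * r ^ j ≤ A * B := by
  have hA : 0 ≤ A := le_trans (by positivity) (hF 0)
  have hB : 0 ≤ B := le_trans (by positivity) (hG 0)
  rw [PowerSeries.coeff_mul]
  obtain ⟨x, hx, h⟩ := IsUltrametricDist.exists_norm_finsetSum_le_of_nonempty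
    (t := Finset.HasAntidiagonal.antidiagonal j) ⟨(0, j), by simp⟩
    (fun p => PowerSeries.coeff p.1 F * PowerSeries.coeff p.2 G)
  refine (mul_le_mul_of_nonneg_right h (by positivity)).trans ?_
  rw [← Finset.HasAntidiagonal.mem_antidiagonal.1 hx, norm_mul, pow_add, mul_mul_mul_comm]
  exact mul_le_mul (hF _) (hG _) (by positivity) hA

theorem norm_coeff_prod_le {ι : Type*} {r : ℝ} (hr : 0 ≤ r) {F : ι → PowerSeries C} {A : ι → ℝ}
    (s : Finset ι) (hF : ∀ i ∈ s, ∀ j, ‖PowerSeries.coeff j (F i)‖ * r ^ j ≤ A i) (j : ℕ) :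
    ‖PowerSeries.coeff j (∏ i ∈ s, F i)‖ * r ^ j ≤ ∏ i ∈ s, A i := by
  induction s using Finset.induction_on generalizing j with
  | empty =>
    rw [Finset.prod_empty, Finset.prod_empty, PowerSeries.coeff_one]
    split_ifs with h <;> simp [h]
  | insert a s ha ih =>
    rw [Finset.prod_insert ha, Finset.prod_insert ha]
    exact norm_coeff_mul_le hr (hF a (Finset.mem_insert_self _ _))
      (ih fun i hi => hF i (Finset.mem_insert_of_mem hi)) j

theorem norm_coeff_prod_one_sub_le {r : ℝ} (hr : 0 ≤ r) (s : Finset C) (j : ℕ) :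
    ‖PowerSeries.coeff j (∏ l ∈ s, (1 - PowerSeries.C l⁻¹ * PowerSeries.X))‖ * r ^ j ≤
      ∏ l ∈ s, max 1 (r / ‖l‖) := by
  refine norm_coeff_prod_le hr s (fun l _ j => ?_) j
  rcases j with - | - | j
  · simp
  · simp [PowerSeries.coeff_one, div_eq_inv_mul]
  · simp [PowerSeries.coeff_one]

/-- The maximum of `|X ∏ (1 - X / l)|`, the product over the nonzero `l` in `s`, on the closed
disk of radius `r`, when `s` is contained in it. -/
def growth (s : Finset C) (r : ℝ) : ℝ := r * ∏ l ∈ s.erase 0, (r / ‖l‖)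

theorem one_le_div_norm {r : ℝ} {u : Finset C} (hu : ∀ l ∈ u, ‖l‖ ≤ r) {l : C}
    (hl : l ∈ u.erase 0) : 1 ≤ r / ‖l‖ :=
  (one_le_div (norm_pos_iff.2 (Finset.ne_of_mem_erase hl))).2 (hu l (Finset.mem_of_mem_erase hl))

theorem le_growth {r : ℝ} (hr : 0 ≤ r) {u : Finset C} (hu : ∀ l ∈ u, ‖l‖ ≤ r) :
    r ≤ growth u r :=
  le_mul_of_one_le_right hr (Finset.one_le_prod fun _ hl => one_le_div_norm hu hl)

/-- Points outside the disk contribute `1`, and points of `u` missing from `s` would contribute at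
least `1`. The bound does not depend on `s`, hence is uniform along an exhaustion. -/
theorem prod_max_le {r : ℝ} {s u : Finset C} (hu : ∀ l ∈ u, ‖l‖ ≤ r)
    (hsu : ∀ l ∈ s, ‖l‖ ≤ r → l ∈ u) :
    ∏ l ∈ s, max 1 (r / ‖l‖) ≤ ∏ l ∈ u.erase 0, (r / ‖l‖) := by
  have h : ∏ l ∈ s, max 1 (r / ‖l‖) = ∏ l ∈ s ∩ u.erase 0, max 1 (r / ‖l‖) := by
    refine (Finset.prod_subset Finset.inter_subset_left fun l hl hl' => ?_).symm
    by_cases h0 : l = 0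
    · simp [h0]
    · refine max_eq_left ((div_le_one (norm_pos_iff.2 h0)).2 ?_)
      by_contra! h
      exact hl' (Finset.mem_inter.2 ⟨hl, Finset.mem_erase.2 ⟨h0, hsu l hl h.le⟩⟩)
  rw [h, Finset.prod_congr rfl fun l hl =>
    max_eq_right (one_le_div_norm hu (Finset.mem_inter.1 hl).2)]
  rw [← Finset.prod_sdiff (Finset.inter_subset_right (s₁ := s) (s₂ := u.erase 0))]
  refine le_mul_of_one_le_left ?_ (Finset.one_le_prod fun l hl =>
    one_le_div_norm hu (Finset.mem_sdiff.1 hl).1)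
  exact Finset.prod_nonneg fun l hl =>
    zero_le_one.trans (one_le_div_norm hu (Finset.mem_inter.1 hl).2)

theorem coe_expPoly (s : Finset C) : (expPoly s : PowerSeries C) =
    PowerSeries.X * ∏ l ∈ s.erase 0, (1 - PowerSeries.C l⁻¹ * PowerSeries.X) := by
  have h := congrArg (Polynomial.coeToPowerSeries.ringHom (R := C)) (expPoly.eq_1 s)
  simpa only [map_prod, map_sub, map_mul, map_one,
    coeToPowerSeries.ringHom_apply, coe_C, coe_X] using h

theorem norm_coeff_expPoly_le {r : ℝ} (hr : 0 ≤ r) {s u : Finset C} (hu : ∀ l ∈ u, ‖l‖ ≤ r)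
    (hsu : ∀ l ∈ s, ‖l‖ ≤ r → l ∈ u) (j : ℕ) :
    ‖(expPoly s).coeff j‖ * r ^ j ≤ growth u r := by
  rw [← Polynomial.coeff_coe, coe_expPoly]
  refine norm_coeff_mul_le hr (fun j => ?_) (fun j => (norm_coeff_prod_one_sub_le hr _ j).trans
    (prod_max_le hu fun l hl => hsu l (Finset.mem_of_mem_erase hl))) j
  rw [PowerSeries.coeff_X]
  split_ifs with h <;> simp [h, hr]

/-- In `mk_powerSum` the series `∏ 1/(1 - lX)` has Gauss norm at most `1` at radius `1/r`, and the
constant `p` has norm `∏ ‖l‖`, which cancels the denominator of `growth`. -/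
theorem growth_mul_norm_powerSum_le {r : ℝ} (hr : 0 < r) {s : Finset C} (hs : ∀ l ∈ s, ‖l‖ ≤ r)
    (h0 : 0 ∈ s) (hder : derivative (vanishing s) = Polynomial.C (∏ l ∈ s.erase 0, -l)) (k : ℕ) :
    growth s r * ‖∑ l ∈ s, l ^ k‖ ≤ r ^ (k + 1) := by
  by_cases hk : k < s.card - 1
  · rw [powerSum_eq_zero hder hk]
    simp only [norm_zero, mul_zero]
    positivity
  have h := congrArg (PowerSeries.coeff k) (mk_powerSum hder)
  rw [PowerSeries.coeff_mk, mul_assoc, PowerSeries.coeff_C_mul, PowerSeries.coeff_X_pow_mul',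
    if_pos (not_lt.1 hk)] at h
  have hb := norm_coeff_prod_le (inv_nonneg.2 hr.le) s
    (F := fun l : C => PowerSeries.mk fun k => l ^ k) (A := fun _ => 1) (fun l hl j => by
      rw [PowerSeries.coeff_mk, norm_pow, ← mul_pow]
      refine pow_le_one₀ (by positivity) ?_
      rw [← div_eq_mul_inv]
      exact (div_le_one hr).2 (hs l hl)) (k - (s.card - 1))
  set c := PowerSeries.coeff (k - (s.card - 1)) (∏ l ∈ s, PowerSeries.mk fun k => l ^ k)
  rw [Finset.prod_const_one, inv_pow, ← div_eq_mul_inv, div_le_one (by positivity)] at hb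
  have hp : ‖∏ l ∈ s.erase 0, -l‖ = ∏ l ∈ s.erase 0, ‖l‖ := by
    rw [norm_prod]
    simp
  have hp0 : ∏ l ∈ s.erase 0, ‖l‖ ≠ 0 := by
    rw [← hp, norm_ne_zero_iff]
    exact prod_erase_neg_ne_zero s
  rw [h, norm_mul, hp, growth, Finset.prod_div_distrib, Finset.prod_const,
    Finset.card_erase_of_mem h0]
  calc r * (r ^ (s.card - 1) / ∏ l ∈ s.erase 0, ‖l‖) * ((∏ l ∈ s.erase 0, ‖l‖) * ‖c‖)
      = r * r ^ (s.card - 1) * ‖c‖ := by field_simp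
    _ ≤ r * r ^ (s.card - 1) * r ^ (k - (s.card - 1)) := by gcongr
    _ = r ^ (k + 1) := by
      rw [mul_assoc, ← pow_add, ← pow_succ']
      congr 1
      omega

end GaussBound

/-! ### Growth and convergence of series with exponents `q ^ n` -/

section Entire

/-- If the bound failed at `n`, the hypothesis would force `u (n+1) ≥ u n ^ q > 1`, and so on,
contradicting boundedness. The bound `B` is only qualitative and disappears from the conclusion. -/
theorem pow_le_max_one_of_pow_le_max {u : ℕ → ℝ} {q : ℕ} (hq : 2 ≤ q) {A B : ℝ}
    (hu0 : ∀ n, 0 ≤ u n) (hB : ∀ n, u n ≤ B) (hu : ∀ n, u n ^ q ≤ max A (u (n + 1))) (n : ℕ) :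
    u n ^ q ≤ max 1 A := by
  by_contra! h
  obtain ⟨h1, hA⟩ := max_lt_iff.1 h
  have ha : 1 < u n := by
    by_contra! h'
    exact h1.not_ge (pow_le_one₀ (hu0 n) h')
  have key (k : ℕ) : u n ^ (k + 1) ≤ u (n + k) := by
    induction k with
    | zero => simp
    | succ k ih =>
      have h2 : u n ^ (k + 2) ≤ u (n + k) ^ q := by
        refine le_trans ?_ (pow_le_pow_left₀ (by positivity) ih q)
        rw [← pow_mul]
        exact pow_le_pow_right₀ ha.le (by nlinarith)
      have h3 : u n ^ q ≤ u (n + k) ^ q := by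
        refine pow_le_pow_left₀ (hu0 n) (le_trans ?_ ih) q
        exact le_self_pow₀ ha.le k.succ_ne_zero
      exact h2.trans ((le_max_iff.1 (hu (n + k))).resolve_left (by linarith))
  obtain ⟨k, hk⟩ := pow_unbounded_of_one_lt B ha
  have := key k
  have := hB (n + k)
  have := pow_le_pow_right₀ ha.le (k.le_add_right 1)
  linarith

variable {C : Type*} [NontriviallyNormedField C]

/-- A geometric majorant, from `q ^ n ≥ n`. -/
theorem norm_mul_pow_card_pow_le {q : ℕ} (hq : 2 ≤ q) {a x : C} {r B : ℝ} (hxr : ‖x‖ < r) {n : ℕ}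
    (ha : ‖a‖ * r ^ q ^ n ≤ B) : ‖a * x ^ q ^ n‖ ≤ B * (‖x‖ / r) ^ n := by
  have hr : 0 < r := (norm_nonneg x).trans_lt hxr
  have hx1 : ‖x‖ / r ≤ 1 := (div_le_one hr).2 hxr.le
  have h : ‖a * x ^ q ^ n‖ = ‖a‖ * r ^ q ^ n * (‖x‖ / r) ^ q ^ n := by
    rw [norm_mul, norm_pow, div_pow]
    field_simp
  rw [h]
  exact mul_le_mul ha (pow_le_pow_of_le_one (by positivity) hx1 (Nat.lt_pow_self hq).le)
    (by positivity) (le_trans (by positivity) ha)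

theorem summable_mul_geometric {x : C} {r : ℝ} (B : ℝ) (hxr : ‖x‖ < r) :
    Summable fun n : ℕ => B * (‖x‖ / r) ^ n := by
  have hr : 0 < r := (norm_nonneg x).trans_lt hxr
  exact (summable_geometric_of_lt_one (by positivity) ((div_lt_one hr).2 hxr)).mul_left B

theorem summable_of_norm_mul_pow_le [CompleteSpace C] {q : ℕ} (hq : 2 ≤ q) {a : ℕ → C} {x : C} {r B : ℝ}
    (hxr : ‖x‖ < r) (ha : ∀ n, ‖a n‖ * r ^ q ^ n ≤ B) : Summable fun n => a n * x ^ q ^ n :=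
  .of_norm_bounded (summable_mul_geometric B hxr) fun n => norm_mul_pow_card_pow_le hq hxr (ha n)

theorem tendsto_tsum_of_norm_mul_pow_le [CompleteSpace C] {q : ℕ} (hq : 2 ≤ q) {a : ℕ → ℕ → C} {b : ℕ → C} {x : C}
    {r B : ℝ} (hxr : ‖x‖ < r) (ha : ∀ m n, ‖a m n‖ * r ^ q ^ n ≤ B)
    (hab : ∀ n, Tendsto (fun m => a m n) atTop (𝓝 (b n))) :
    Tendsto (fun m => ∑' n, a m n * x ^ q ^ n) atTop (𝓝 (∑' n, b n * x ^ q ^ n)) :=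
  tendsto_tsum_of_dominated_convergence (summable_mul_geometric B hxr)
    (fun n => (hab n).mul_const _)
    (Eventually.of_forall fun m n => norm_mul_pow_card_pow_le hq hxr (ha m n))

theorem norm_mul_pow_le_of_tendsto {a : ℕ → C} {b : C} {B c : ℝ}
    (hab : Tendsto a atTop (𝓝 b)) (ha : ∀ m, ‖a m‖ * c ≤ B) : ‖b‖ * c ≤ B :=
  le_of_tendsto (hab.norm.mul_const c) (Eventually.of_forall ha)

variable {Fq : Type*} [Field Fq] [Fintype Fq] [Algebra Fq C]

theorem two_le_card : 2 ≤ Fintype.card Fq := Fintype.one_lt_card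

theorem hasSum_eval_of_mem_linearized {P : C[X]} (hP : P ∈ linearized Fq C) (x : C) :
    HasSum (fun n => P.coeff (Fintype.card Fq ^ n) * x ^ Fintype.card Fq ^ n) (P.eval x) := by
  have hd : P.natDegree < Fintype.card Fq ^ (P.natDegree + 1) :=
    (Nat.lt_succ_self _).trans (Nat.lt_pow_self Fintype.one_lt_card)
  rw [sum_coeff_of_mem_linearized hP hd]
  refine hasSum_sum_of_ne_finset_zero fun n hn => ?_
  rw [Finset.mem_range, not_lt] at hn
  rw [coeff_eq_zero_of_natDegree_lt
    (hd.trans_le (Nat.pow_le_pow_right Fintype.card_pos hn)), zero_mul]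

theorem norm_coeff_mul_pow_le (P : C[X]) {r : ℝ} (hr : 0 ≤ r) (k : ℕ) :
    ‖P.coeff k‖ * r ^ k ≤ ∑ j ∈ P.support, ‖P.coeff j‖ * r ^ j := by
  by_cases hk : k ∈ P.support
  · exact Finset.single_le_sum (f := fun j => ‖P.coeff j‖ * r ^ j)
      (fun _ _ => by positivity) hk
  · rw [notMem_support_iff.1 hk, norm_zero, zero_mul]
    positivity

theorem norm_algebraMap_le_one (a : Fq) : ‖algebraMap Fq C a‖ ≤ 1 := by
  have h : ‖algebraMap Fq C a‖ ^ Fintype.card Fq = ‖algebraMap Fq C a‖ := by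
    rw [← norm_pow, ← map_pow, FiniteField.pow_card]
  by_contra! h1
  exact (lt_self_pow₀ h1 Fintype.one_lt_card).ne' h

end Entire

/-! ## Poonen's series, by coefficients -/

section Poonen

variable (Fq : Type*) {C : Type*} [Field Fq] [Fintype Fq]

/-- The coefficients of the series `g` with `β ∑ eᵢ τⁱ = (1 - τ) g`. -/
def poonenCoeff [Field C] (e : ℕ → C) (β : C) : ℕ → C
  | 0 => β * e 0
  | n + 1 => β * e (n + 1) + poonenCoeff e β n ^ Fintype.card Fq

variable {Fq} [NontriviallyNormedField C] [Algebra Fq C]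

theorem tendsto_poonenCoeff {e : ℕ → ℕ → C} {e' : ℕ → C} {β : ℕ → C} {β' : C}
    (he : ∀ n, Tendsto (fun m => e m n) atTop (𝓝 (e' n))) (hβ : Tendsto β atTop (𝓝 β')) (n : ℕ) :
    Tendsto (fun m => poonenCoeff Fq (e m) (β m) n) atTop (𝓝 (poonenCoeff Fq e' β' n)) := by
  induction n with
  | zero => exact hβ.mul (he 0)
  | succ n ih => exact (hβ.mul (he (n + 1))).add (ih.pow _)

/-- An interpolating polynomial is thus itself the Poonen series of the finite-level exponential
`E`. -/
theorem coeff_eq_poonenCoeff {h E : C[X]} (hh : h ∈ linearized Fq C) {β : C}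
    (hE : h - h ^ Fintype.card Fq = Polynomial.C β * E) (n : ℕ) :
    h.coeff (Fintype.card Fq ^ n) = poonenCoeff Fq (fun n => E.coeff (Fintype.card Fq ^ n)) β n := by
  induction n with
  | zero =>
    have := congrArg (fun P => P.coeff 1) hE
    simp only [coeff_sub, coeff_one_pow_card_of_mem_linearized hh, sub_zero, coeff_C_mul] at this
    simpa [poonenCoeff] using this
  | succ n ih =>
    have := congrArg (fun P => P.coeff (Fintype.card Fq ^ (n + 1))) hE
    simp only [coeff_sub, coeff_succ_pow_card_of_mem_linearized hh, coeff_C_mul] at this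
    rw [poonenCoeff, ← ih, ← this, sub_add_cancel]

/-- Since `g_n^q = g_{n+1} - β e_{n+1}`, the numbers `‖g_n‖ r^(q^n)` satisfy the hypothesis of
`pow_le_max_one_of_pow_le_max` with `A = ‖β‖T`. -/
theorem poonenCoeff_bound [IsUltrametricDist C] {e : ℕ → C} {β : C} {r T B : ℝ} (hr : 0 < r)
    (he : ∀ n, ‖e n‖ * r ^ Fintype.card Fq ^ n ≤ T)
    (hB : ∀ n, ‖poonenCoeff Fq e β n‖ * r ^ Fintype.card Fq ^ n ≤ B) (n : ℕ) :
    (‖poonenCoeff Fq e β n‖ * r ^ Fintype.card Fq ^ n) ^ Fintype.card Fq ≤ max 1 (‖β‖ * T) := by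
  refine pow_le_max_one_of_pow_le_max
    (u := fun n => ‖poonenCoeff Fq e β n‖ * r ^ Fintype.card Fq ^ n) two_le_card
    (fun n => by positivity) hB (fun n => ?_) n
  have h : poonenCoeff Fq e β n ^ Fintype.card Fq =
      poonenCoeff Fq e β (n + 1) - β * e (n + 1) := by
    rw [poonenCoeff]
    ring
  rw [mul_pow, ← norm_pow, h, ← pow_mul, ← pow_succ]
  refine (mul_le_mul_of_nonneg_right (?_ : _ ≤
    max ‖poonenCoeff Fq e β (n + 1)‖ ‖β * e (n + 1)‖) (by positivity)).trans ?_
  · rw [sub_eq_add_neg, ← norm_neg (β * e (n + 1))]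
    exact IsUltrametricDist.norm_add_le_max _ _
  rw [max_mul_of_nonneg _ _ (by positivity), max_comm, norm_mul, mul_assoc]
  exact max_le_max_right _ (mul_le_mul_of_nonneg_left (he _) (norm_nonneg _))

/-- The relation `β exp = (1 - τ) g`, evaluated at `x`. -/
theorem hasSum_of_hasSum_poonenCoeff {e : ℕ → C} {β x y : C}
    (h : HasSum (fun n => poonenCoeff Fq e β n * x ^ Fintype.card Fq ^ n) y) :
    HasSum (fun n => β * (e n * x ^ Fintype.card Fq ^ n)) (y - y ^ Fintype.card Fq) := by
  have h1 : HasSum (fun n => (poonenCoeff Fq e β n * x ^ Fintype.card Fq ^ n) ^ Fintype.card Fq)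
      (y ^ Fintype.card Fq) :=
    h.map (FiniteField.frobeniusAlgHom Fq C) (continuous_pow _)
  have h2 := (hasSum_nat_add_iff' 1).2 h
  rw [← hasSum_nat_add_iff' 1]
  convert h2.sub h1 using 1
  · funext n
    rw [poonenCoeff, mul_pow, ← pow_mul, ← pow_succ]
    ring
  · simp only [Finset.sum_range_one, poonenCoeff]
    ring

theorem exists_hasSum_algebraMap_of_hasSum_zero [CompleteSpace C] {e : ℕ → C} {β x : C} {r B : ℝ}
    (hxr : ‖x‖ < r) (hB : ∀ n, ‖poonenCoeff Fq e β n‖ * r ^ Fintype.card Fq ^ n ≤ B)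
    (he : HasSum (fun n => e n * x ^ Fintype.card Fq ^ n) 0) :
    ∃ a : Fq, HasSum (fun n => poonenCoeff Fq e β n * x ^ Fintype.card Fq ^ n)
      (algebraMap Fq C a) := by
  have h := (summable_of_norm_mul_pow_le two_le_card hxr hB).hasSum
  have h2 := (hasSum_of_hasSum_poonenCoeff h).unique (he.mul_left β)
  rw [mul_zero, sub_eq_zero] at h2
  obtain ⟨a, ha⟩ := exists_algebraMap_eq_of_pow_card_eq h2.symm
  exact ⟨a, ha ▸ h⟩

end Poonen

/-! ## Strongly discrete subspaces -/

section Lattice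

variable {Fq C : Type*} [Field Fq] [Fintype Fq] [NontriviallyNormedField C] [Algebra Fq C]
  {L : Submodule Fq C}

/-- A subspace meeting every ball in a finite set. -/
def StronglyDiscrete (L : Submodule Fq C) : Prop :=
  ∀ r : ℝ, ((L : Set C) ∩ Metric.closedBall 0 r).Finite

/-- The elements of norm at most `r`. -/
def StronglyDiscrete.ball (hL : StronglyDiscrete L) (r : ℝ) : Finset C := (hL r).toFinset

theorem StronglyDiscrete.mem_ball (hL : StronglyDiscrete L) {r : ℝ} {x : C} :
    x ∈ hL.ball r ↔ x ∈ L ∧ ‖x‖ ≤ r := by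
  rw [ball, Set.Finite.mem_toFinset, Set.mem_inter_iff, mem_closedBall_zero_iff]
  rfl

theorem StronglyDiscrete.zero_mem_ball (hL : StronglyDiscrete L) {r : ℝ} (hr : 0 ≤ r) :
    0 ∈ hL.ball r :=
  hL.mem_ball.2 ⟨L.zero_mem, by rwa [norm_zero]⟩

/-- The nonzero elements of a subspace, as elements of the ambient field. -/
def nonzeroEmb (L : Submodule Fq C) : {l : L // l ≠ 0} ↪ C :=
  (Function.Embedding.subtype _).trans (Function.Embedding.subtype _)

/-- The nonzero elements of norm at most `r`. -/
def StronglyDiscrete.nonzeroBall (hL : StronglyDiscrete L) (r : ℝ) : Finset {l : L // l ≠ 0} :=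
  ((hL r).preimage (nonzeroEmb L).injective.injOn).toFinset

theorem StronglyDiscrete.mem_nonzeroBall (hL : StronglyDiscrete L) {r : ℝ} {l : {l : L // l ≠ 0}} :
    l ∈ hL.nonzeroBall r ↔ ‖(l : C)‖ ≤ r := by
  rw [nonzeroBall, Set.Finite.mem_toFinset, Set.mem_preimage, Set.mem_inter_iff,
    mem_closedBall_zero_iff]
  exact and_iff_right l.1.2

theorem StronglyDiscrete.map_nonzeroBall (hL : StronglyDiscrete L) (r : ℝ) :
    (hL.nonzeroBall r).map (nonzeroEmb L) = (hL.ball r).erase 0 := by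
  ext x
  rw [Finset.mem_map, Finset.mem_erase, hL.mem_ball]
  constructor
  · rintro ⟨l, hl, rfl⟩
    exact ⟨fun h => l.2 (Subtype.ext h), l.1.2, hL.mem_nonzeroBall.1 hl⟩
  · rintro ⟨h0, hx, hr⟩
    exact ⟨⟨⟨x, hx⟩, fun h => h0 (congrArg Subtype.val h)⟩, hL.mem_nonzeroBall.2 hr, rfl⟩

theorem StronglyDiscrete.tendsto_nonzeroBall (hL : StronglyDiscrete L) :
    Tendsto (fun m : ℕ => hL.nonzeroBall m) atTop atTop := by
  refine tendsto_atTop_finset_of_monotone (fun m n hmn l hl => ?_) fun l => ?_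
  · exact hL.mem_nonzeroBall.2 ((hL.mem_nonzeroBall.1 hl).trans (by exact_mod_cast hmn))
  · obtain ⟨n, hn⟩ := exists_nat_ge ‖(l : C)‖
    exact ⟨n, hL.mem_nonzeroBall.2 hn⟩

theorem StronglyDiscrete.tendsto_sum_ball (hL : StronglyDiscrete L) {F : C → C} {a : C}
    (h : HasSum (fun l : {l : L // l ≠ 0} => F l) a) :
    Tendsto (fun m : ℕ => ∑ l ∈ (hL.ball m).erase 0, F l) atTop (𝓝 a) := by
  have := Tendsto.comp h hL.tendsto_nonzeroBall
  refine this.congr fun m => ?_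
  rw [← hL.map_nonzeroBall, Finset.sum_map]
  rfl

variable [IsUltrametricDist C]

/-- In a complete ultrametric field it suffices that terms tend to `0`: a term of norm at least `ε`
has `‖l‖ ≤ ε⁻¹`. -/
theorem StronglyDiscrete.summable_div [CompleteSpace C] (hL : StronglyDiscrete L) {F : C → C}
    (hF : ∀ l ∈ L, ‖F l‖ ≤ 1) : Summable fun l : {l : L // l ≠ 0} => F l / l := by
  refine NonarchimedeanAddGroup.summable_of_tendsto_cofinite_zero ?_
  rw [Metric.tendsto_nhds]
  intro ε hε
  rw [eventually_cofinite]
  refine (hL.nonzeroBall ε⁻¹).finite_toSet.subset fun l hl => ?_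
  rw [Set.mem_ofPred_eq, dist_zero_right, not_lt, norm_div] at hl
  refine hL.mem_nonzeroBall.2 ?_
  have hl0 : 0 < ‖(l : C)‖ := norm_pos_iff.2 fun h => l.2 (Subtype.ext h)
  rw [le_inv_comm₀ hl0 hε, ← one_div]
  exact hl.trans (div_le_div_of_nonneg_right (hF _ l.1.2) hl0.le)

/-- The subspace of the elements of norm at most `r`. -/
def ballSubmodule (L : Submodule Fq C) {r : ℝ} (hr : 0 ≤ r) : Submodule Fq C where
  carrier := {x | x ∈ L ∧ ‖x‖ ≤ r}
  add_mem' hx hy := ⟨L.add_mem hx.1 hy.1,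
    (IsUltrametricDist.norm_add_le_max _ _).trans (max_le hx.2 hy.2)⟩
  zero_mem' := ⟨L.zero_mem, by rwa [norm_zero]⟩
  smul_mem' a x hx := ⟨L.smul_mem a hx.1, by
    rw [Algebra.smul_def, norm_mul]
    exact (mul_le_of_le_one_left (norm_nonneg _) (norm_algebraMap_le_one a)).trans hx.2⟩

theorem StronglyDiscrete.coe_ball (hL : StronglyDiscrete L) {r : ℝ} (hr : 0 ≤ r) :
    (hL.ball r : Set C) = ballSubmodule L hr := by
  ext x
  exact hL.mem_ball

variable {e : ℕ → C}

/-- The `e i` are the coefficients of `X ^ (q ^ i)` in the exponential of `L`. -/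
def StronglyDiscrete.IsExpCoeff (hL : StronglyDiscrete L) (e : ℕ → C) : Prop :=
  ∀ n, Tendsto (fun m : ℕ => (expPoly (hL.ball m)).coeff (Fintype.card Fq ^ n)) atTop (𝓝 (e n))

namespace StronglyDiscrete

theorem norm_coeff_expPoly_ball_le (hL : StronglyDiscrete L) {r : ℝ} (hr : 0 ≤ r) (m j : ℕ) :
    ‖(expPoly (hL.ball m)).coeff j‖ * r ^ j ≤ growth (hL.ball r) r :=
  norm_coeff_expPoly_le hr (fun _ hl => (hL.mem_ball.1 hl).2)
    (fun _ hl hlr => hL.mem_ball.2 ⟨(hL.mem_ball.1 hl).1, hlr⟩) j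

variable {hL : StronglyDiscrete L}

theorem IsExpCoeff.norm_mul_pow_le (he : hL.IsExpCoeff e) {r : ℝ} (hr : 0 ≤ r) (n : ℕ) :
    ‖e n‖ * r ^ Fintype.card Fq ^ n ≤ growth (hL.ball r) r :=
  norm_mul_pow_le_of_tendsto (he n) fun m => hL.norm_coeff_expPoly_ball_le hr m _

theorem IsExpCoeff.coeff_zero (he : hL.IsExpCoeff e) : e 0 = 1 := by
  refine tendsto_nhds_unique (he 0) ?_
  simp only [pow_zero, coeff_one_expPoly]
  exact tendsto_const_nhds

/-- The finite-level polynomials vanish at `l` as soon as their ball contains it, and dominated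
convergence passes to the limit. -/
theorem IsExpCoeff.hasSum_zero [CompleteSpace C] (he : hL.IsExpCoeff e) {l : C} (hl : l ∈ L) :
    HasSum (fun n => e n * l ^ Fintype.card Fq ^ n) 0 := by
  have hlr : ‖l‖ < ‖l‖ + 1 := by linarith
  have hr : 0 ≤ ‖l‖ + 1 := by positivity
  have hsum := summable_of_norm_mul_pow_le two_le_card hlr fun n => he.norm_mul_pow_le hr n
  have hlim := tendsto_tsum_of_norm_mul_pow_le two_le_card hlr
    (fun m n => hL.norm_coeff_expPoly_ball_le hr m (Fintype.card Fq ^ n)) he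
  convert hsum.hasSum using 1
  refine tendsto_nhds_unique (tendsto_const_nhds.congr' ?_) hlim
  obtain ⟨N, hN⟩ := exists_nat_ge ‖l‖
  filter_upwards [eventually_ge_atTop N] with m hm
  have hmem : l ∈ hL.ball m := hL.mem_ball.2 ⟨hl, hN.trans (by exact_mod_cast hm)⟩
  rw [(hasSum_eval_of_mem_linearized
    (expPoly_mem_linearized (hL.coe_ball (Nat.cast_nonneg m))) l).tsum_eq, eval_expPoly hmem]

/-- The residue formula, with an error bounded through the growth of the exponential. -/
theorem IsExpCoeff.norm_sum_add_le [CompleteSpace C] (he : hL.IsExpCoeff e) {β : C} {r B : ℝ}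
    (hr : 1 ≤ r) (hB : ∀ n, ‖poonenCoeff Fq e β n‖ * (r + 1) ^ Fintype.card Fq ^ n ≤ B) :
    ‖∑ l ∈ (hL.ball r).erase 0, (∑' n, poonenCoeff Fq e β n * l ^ Fintype.card Fq ^ n) / l + β‖ ^
      Fintype.card Fq ≤ max 1 ‖β‖ / r := by
  have hr0 : 0 < r := by linarith
  have hq0 : Fintype.card Fq ≠ 0 := Fintype.card_ne_zero
  set s := hL.ball r
  set T := growth s r
  have hsr : ∀ l ∈ s, ‖l‖ ≤ r := fun l hl => (hL.mem_ball.1 hl).2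
  have h0 : 0 ∈ s := hL.zero_mem_ball hr0.le
  have hrT : r ≤ T := le_growth hr0.le hsr
  have hT0 : 0 < T := hr0.trans_le hrT
  have hB' (n : ℕ) : ‖poonenCoeff Fq e β n‖ * r ^ Fintype.card Fq ^ n ≤ B :=
    le_trans (by gcongr; linarith) (hB n)
  have hsum : HasSum (fun n => poonenCoeff Fq e β n * ∑ l ∈ s, l ^ (Fintype.card Fq ^ n - 1))
      (∑ l ∈ s.erase 0, (∑' n, poonenCoeff Fq e β n * l ^ Fintype.card Fq ^ n) / l + β) := by
    have h1 : HasSum (fun n => ∑ l ∈ s.erase 0, poonenCoeff Fq e β n * l ^ Fintype.card Fq ^ n / l)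
        (∑ l ∈ s.erase 0, (∑' n, poonenCoeff Fq e β n * l ^ Fintype.card Fq ^ n) / l) := by
      refine hasSum_sum fun l hl => HasSum.div_const (Summable.hasSum ?_) l
      -- Radius `r + 1` leaves room for points of norm exactly `r`.
      exact summable_of_norm_mul_pow_le two_le_card
        (by linarith [hsr l (Finset.mem_of_mem_erase hl)]) hB
    -- The power sum of exponent `0` also counts `l = 0`; the surplus `g_0 = β e_0 = β` is the
    -- summand `β`.
    have h2 : HasSum (fun n : ℕ => if n = 0 then β else 0) β := hasSum_ite_eq 0 β
    convert h1.add h2 using 1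
    funext n
    simp_rw [mul_div_assoc]
    rw [← Finset.mul_sum, sum_erase_pow_div h0 (pow_pos Fintype.card_pos n)]
    rcases n with - | n
    · simp [poonenCoeff, he.coeff_zero]
      ring
    · rw [if_neg (Nat.one_lt_pow n.succ_ne_zero Fintype.one_lt_card).ne', if_neg n.succ_ne_zero]
      ring
  have hM0 : 0 ≤ max 1 (‖β‖ * T) := zero_le_one.trans (le_max_left _ _)
  -- The `q`-th root of the bound in `poonenCoeff_bound`.
  set c : ℝ := max 1 (‖β‖ * T) ^ ((Fintype.card Fq : ℝ)⁻¹)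
  have hc0 : 0 ≤ c := Real.rpow_nonneg hM0 _
  have hcq : c ^ Fintype.card Fq = max 1 (‖β‖ * T) := Real.rpow_inv_natCast_pow hM0 hq0
  have hterm (n : ℕ) :
      ‖poonenCoeff Fq e β n * ∑ l ∈ s, l ^ (Fintype.card Fq ^ n - 1)‖ ≤ c / T := by
    rw [le_div_iff₀ hT0, norm_mul]
    have h1 := growth_mul_norm_powerSum_le hr0 hsr h0
      (derivative_vanishing (hL.coe_ball hr0.le)) (Fintype.card Fq ^ n - 1)
    rw [Nat.sub_add_cancel (pow_pos Fintype.card_pos n)] at h1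
    have h2 := poonenCoeff_bound hr0 (fun n => he.norm_mul_pow_le hr0.le n) hB' n
    rw [← hcq] at h2
    refine le_trans ?_ ((pow_le_pow_iff_left₀ (by positivity) hc0 hq0).1 h2)
    rw [mul_assoc]
    gcongr
    rwa [mul_comm]
  have hnorm := IsUltrametricDist.norm_tsum_le_of_forall_le_of_nonneg
    (div_nonneg hc0 hT0.le) hterm
  rw [hsum.tsum_eq] at hnorm
  refine (pow_le_pow_left₀ (norm_nonneg _) hnorm _).trans ?_
  rw [div_pow, hcq, div_le_div_iff₀ (by positivity) hr0]
  have h1 : max 1 (‖β‖ * T) ≤ max 1 ‖β‖ * T := by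
    refine max_le ?_ (by gcongr; exact le_max_right _ _)
    nlinarith [le_max_left 1 ‖β‖]
  -- Here `q ≥ 2` is essential: one factor `T` absorbs `‖β‖T`, the other is at least `r`.
  have h2 : T * T ≤ T ^ Fintype.card Fq := by
    rw [← sq]
    exact pow_le_pow_right₀ (by linarith) two_le_card
  calc max 1 (‖β‖ * T) * r ≤ max 1 ‖β‖ * T * T := by gcongr
    _ = max 1 ‖β‖ * (T * T) := by ring
    _ ≤ max 1 ‖β‖ * T ^ Fintype.card Fq := by gcongr

theorem IsExpCoeff.tendsto_sum [CompleteSpace C] (he : hL.IsExpCoeff e) {β : C}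
    (hB : ∀ r : ℝ, 0 < r → ∃ B, ∀ n, ‖poonenCoeff Fq e β n‖ * r ^ Fintype.card Fq ^ n ≤ B) :
    Tendsto (fun m : ℕ => ∑ l ∈ (hL.ball m).erase 0,
      (∑' n, poonenCoeff Fq e β n * l ^ Fintype.card Fq ^ n) / l) atTop (𝓝 (-β)) := by
  rw [Metric.tendsto_atTop]
  intro ε hε
  have hεq : 0 < ε ^ Fintype.card Fq := by positivity
  obtain ⟨N, hN⟩ := exists_nat_gt (max 1 ‖β‖ / ε ^ Fintype.card Fq)
  refine ⟨N + 1, fun m hm => ?_⟩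
  have hm1 : (1 : ℝ) ≤ m := by exact_mod_cast (Nat.le_add_left 1 N).trans hm
  obtain ⟨B, hB⟩ := hB (m + 1) (by positivity)
  have h := he.norm_sum_add_le hm1 hB
  rw [dist_eq_norm, sub_neg_eq_add]
  refine lt_of_pow_lt_pow_left₀ (Fintype.card Fq) hε.le (h.trans_lt ?_)
  rw [div_lt_comm₀ (by linarith) hεq]
  refine hN.trans ?_
  exact_mod_cast hm

/-- Every linear form on `L` comes from an element of the kernel of the dual exponential. -/
theorem IsExpCoeff.hasSum_of_linearMap [CompleteSpace C] (he : hL.IsExpCoeff e) {β : C}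
    (f : L →ₗ[Fq] Fq)
    (hβ : HasSum (fun l : {l : L // l ≠ 0} => algebraMap Fq C (f l) / (l : C)) (-β)) :
    (∀ r : ℝ, 0 < r → ∃ B, ∀ n, ‖poonenCoeff Fq e β n‖ * r ^ Fintype.card Fq ^ n ≤ B) ∧
    ∀ l : L, HasSum (fun n => poonenCoeff Fq e β n * (l : C) ^ Fintype.card Fq ^ n)
      (algebraMap Fq C (f l)) := by
  let F : C → C := fun x => if hx : x ∈ L then algebraMap Fq C (f ⟨x, hx⟩) else 0
  have hF (l : L) : F l = algebraMap Fq C (f l) := dif_pos l.2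
  let V (m : ℕ) : Submodule Fq C := ballSubmodule L (Nat.cast_nonneg m)
  have hVL (m : ℕ) : V m ≤ L := fun x hx => hx.1
  -- The polynomial `h m` interpolates `f` on the ball of radius `m`; its linear coefficient is a
  -- partial sum tending to `β`.
  choose h hlin hval hE hcoeff using fun m : ℕ =>
    exists_linearized_eq_on (hL.coe_ball (Nat.cast_nonneg m))
      (f.comp (Submodule.inclusion (hVL m)))
  have hval' {m : ℕ} {x : C} (hx : x ∈ hL.ball m) : (h m).eval x = F x := by
    have hxV : x ∈ V m := hL.mem_ball.1 hx
    rw [hval m ⟨x, hxV⟩, hF ⟨x, hxV.1⟩]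
    rfl
  have hβm : Tendsto (fun m => (h m).coeff 1) atTop (𝓝 β) := by
    have h1 : Tendsto (fun m : ℕ => -∑ l ∈ (hL.ball m).erase 0, F l / l) atTop (𝓝 (- -β)) := by
      refine (hL.tendsto_sum_ball (F := fun x => F x / x) ?_).neg
      simpa only [hF] using hβ
    rw [neg_neg] at h1
    refine h1.congr fun m => ?_
    rw [hcoeff m]
    congr 1
    exact Finset.sum_congr rfl fun l hl => by rw [hval' (Finset.mem_of_mem_erase hl)]
  have hg (n : ℕ) : Tendsto (fun m => (h m).coeff (Fintype.card Fq ^ n)) atTop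
      (𝓝 (poonenCoeff Fq e β n)) := by
    simp_rw [fun m => coeff_eq_poonenCoeff (hlin m) (hE m) n]
    exact tendsto_poonenCoeff he hβm n
  obtain ⟨A, hA⟩ := hβm.norm.bddAbove_range
  have hAm (m : ℕ) : ‖(h m).coeff 1‖ ≤ A := hA ⟨m, rfl⟩
  have hbound {r : ℝ} (hr : 0 < r) (m n : ℕ) : ‖(h m).coeff (Fintype.card Fq ^ n)‖ *
      r ^ Fintype.card Fq ^ n ≤ max 1 (A * growth (hL.ball r) r) := by
    have h1 := poonenCoeff_bound (Fq := Fq) (β := (h m).coeff 1) hr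
      -- The bound required of the coefficients may depend on `m`, so the trivial one for a
      -- polynomial suffices; the resulting bound is uniform in `m`.
      (fun n => hL.norm_coeff_expPoly_ball_le hr.le m (Fintype.card Fq ^ n)) (fun n => by
        rw [← coeff_eq_poonenCoeff (hlin m) (hE m) n]
        exact norm_coeff_mul_pow_le (h m) hr.le _) n
    rw [← coeff_eq_poonenCoeff (hlin m) (hE m) n] at h1
    have hT : 0 ≤ growth (hL.ball r) r :=
      hr.le.trans (le_growth hr.le fun _ hl => (hL.mem_ball.1 hl).2)
    have h2 := h1.trans (max_le_max_left 1 (mul_le_mul_of_nonneg_right (hAm m) hT))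
    by_contra! h3
    exact (h3.trans_le (le_self_pow₀ ((le_max_left _ _).trans h3.le) Fintype.card_ne_zero)).not_ge h2
  have hbound' {r : ℝ} (hr : 0 < r) (n : ℕ) : ‖poonenCoeff Fq e β n‖ *
      r ^ Fintype.card Fq ^ n ≤ max 1 (A * growth (hL.ball r) r) :=
    norm_mul_pow_le_of_tendsto (hg n) fun m => hbound hr m n
  refine ⟨fun r hr => ⟨_, hbound' hr⟩, fun l => ?_⟩
  have hlr : ‖(l : C)‖ < ‖(l : C)‖ + 1 := by linarith
  have hr : 0 < ‖(l : C)‖ + 1 := by positivity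
  have hlim := tendsto_tsum_of_norm_mul_pow_le two_le_card hlr (hbound hr) hg
  convert (summable_of_norm_mul_pow_le two_le_card hlr (hbound' hr)).hasSum using 1
  refine tendsto_nhds_unique (tendsto_const_nhds.congr' ?_) hlim
  obtain ⟨N, hN⟩ := exists_nat_ge ‖(l : C)‖
  filter_upwards [eventually_ge_atTop N] with m hm
  have hmem : (l : C) ∈ hL.ball m := hL.mem_ball.2 ⟨l.2, hN.trans (by exact_mod_cast hm)⟩
  rw [(hasSum_eval_of_mem_linearized (hlin m) (l : C)).tsum_eq, hval' hmem, hF]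

end StronglyDiscrete

end Lattice

/-! ## The dual exponential -/

section Dual

variable {Fq C : Type*} [Field Fq] [Fintype Fq] [NontriviallyNormedField C] [Algebra Fq C]
  {σ : C ≃+* C}

theorem symm_iterate_pow (hσ : ∀ x, σ x = x ^ Fintype.card Fq) (n : ℕ) (x : C) :
    (σ.symm^[n] x) ^ Fintype.card Fq ^ n = x := by
  induction n generalizing x with
  | zero => simp
  | succ n ih => rw [Function.iterate_succ_apply, pow_succ, pow_mul, ih, ← hσ,
      RingEquiv.apply_symm_apply]

theorem iterate_eq_pow (hσ : ∀ x, σ x = x ^ Fintype.card Fq) (n : ℕ) (x : C) :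
    σ^[n] x = x ^ Fintype.card Fq ^ n := by
  induction n generalizing x with
  | zero => simp
  | succ n ih => rw [Function.iterate_succ_apply', ih, hσ, pow_succ, pow_mul]

/-- Applying `τ⁻ⁿ` linearizes the recursion: the term `g_{n-1}^q` becomes `τ⁻⁽ⁿ⁻¹⁾(g_{n-1})`. -/
theorem symm_iterate_poonenCoeff (hσ : ∀ x, σ x = x ^ Fintype.card Fq) (e : ℕ → C) (β : C)
    (n : ℕ) : σ.symm^[n] (poonenCoeff Fq e β n) =
      ∑ i ∈ Finset.range (n + 1), σ.symm^[i] (β * e i) := by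
  induction n with
  | zero => simp [poonenCoeff]
  | succ n ih =>
    rw [Finset.sum_range_succ, ← ih, poonenCoeff, iterate_map_add, ← hσ,
      Function.iterate_succ_apply _ n (σ _), RingEquiv.symm_apply_apply, add_comm]

/-- The partial sums `τ⁻ⁿ(g_n)` have norm `‖g_n‖^(1/q^n)`; once this is below `1/r`, the weighted
coefficient is at most `1`. -/
theorem poonenCoeff_bounded_of_hasSum (hσ : ∀ x, σ x = x ^ Fintype.card Fq) {e : ℕ → C} {β : C}
    (h : HasSum (fun i => σ.symm^[i] (β * e i)) 0) {r : ℝ} (hr : 0 < r) :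
    ∃ B, ∀ n, ‖poonenCoeff Fq e β n‖ * r ^ Fintype.card Fq ^ n ≤ B := by
  have hlim : Tendsto (fun n => σ.symm^[n] (poonenCoeff Fq e β n)) atTop (𝓝 0) := by
    simp_rw [symm_iterate_poonenCoeff hσ]
    exact h.tendsto_sum_nat.comp (tendsto_add_atTop_nat 1)
  have hev : ∀ᶠ n in atTop, ‖poonenCoeff Fq e β n‖ * r ^ Fintype.card Fq ^ n ≤ 1 := by
    filter_upwards [Metric.tendsto_nhds.1 hlim r⁻¹ (inv_pos.2 hr)] with n hn
    rw [dist_zero_right] at hn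
    rw [← symm_iterate_pow hσ n (poonenCoeff Fq e β n), norm_pow, ← mul_pow]
    refine pow_le_one₀ (by positivity) ?_
    rw [← le_div_iff₀ hr, one_div]
    exact hn.le
  obtain ⟨N, hN⟩ := eventually_atTop.1 hev
  refine ⟨1 + ∑ n ∈ Finset.range N, ‖poonenCoeff Fq e β n‖ * r ^ Fintype.card Fq ^ n,
    fun n => ?_⟩
  have hnn (n : ℕ) : 0 ≤ ‖poonenCoeff Fq e β n‖ * r ^ Fintype.card Fq ^ n := by positivity
  by_cases hn : N ≤ n
  · exact (hN n hn).trans (le_add_of_nonneg_right (Finset.sum_nonneg fun _ _ => hnn _))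
  · refine (Finset.single_le_sum (fun n _ => hnn n) (Finset.mem_range.2 (not_le.1 hn))).trans ?_
    exact le_add_of_nonneg_left zero_le_one

theorem hasSum_of_poonenCoeff_bounded [CompleteSpace C] [IsUltrametricDist C]
    (hσ : ∀ x, σ x = x ^ Fintype.card Fq) {e : ℕ → C} {β : C}
    (h : ∀ r : ℝ, 0 < r → ∃ B, ∀ n, ‖poonenCoeff Fq e β n‖ * r ^ Fintype.card Fq ^ n ≤ B) :
    HasSum (fun i => σ.symm^[i] (β * e i)) 0 := by
  have hlim : Tendsto (fun n => σ.symm^[n] (poonenCoeff Fq e β n)) atTop (𝓝 0) := by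
    rw [Metric.tendsto_atTop]
    intro ε hε
    -- At this radius, `‖τ⁻ⁿ(g_n)‖ ≥ ε` would make the weighted coefficient at least `2^(q^n)`.
    obtain ⟨B, hB⟩ := h (2 / ε) (by positivity)
    obtain ⟨N, hN⟩ := pow_unbounded_of_one_lt B (one_lt_two (α := ℝ))
    refine ⟨N, fun n hn => ?_⟩
    rw [dist_zero_right]
    by_contra! hle
    have h1 : (2 : ℝ) ^ n ≤ 2 ^ Fintype.card Fq ^ n :=
      pow_le_pow_right₀ one_le_two (Nat.lt_pow_self Fintype.one_lt_card).le
    have h2 : (2 : ℝ) ^ Fintype.card Fq ^ n ≤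
        ‖poonenCoeff Fq e β n‖ * (2 / ε) ^ Fintype.card Fq ^ n := by
      rw [← symm_iterate_pow hσ n (poonenCoeff Fq e β n), norm_pow, ← mul_pow]
      refine pow_le_pow_left₀ zero_le_two ?_ _
      calc (2 : ℝ) = ε * (2 / ε) := by field_simp
        _ ≤ _ := by gcongr
    have h3 : (2 : ℝ) ^ N ≤ 2 ^ n := pow_le_pow_right₀ one_le_two hn
    linarith [hB n]
  have hpart : Tendsto (fun n => ∑ i ∈ Finset.range (n + 1), σ.symm^[i] (β * e i)) atTop (𝓝 0) := by
    simpa only [symm_iterate_poonenCoeff hσ] using hlim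
  have hpart' := (tendsto_add_atTop_iff_nat
    (f := fun n => ∑ i ∈ Finset.range n, σ.symm^[i] (β * e i)) 1).1 hpart
  -- Convergence of partial sums gives null terms, hence unconditional convergence in the
  -- ultrametric setting.
  have hterm : Tendsto (fun i => σ.symm^[i] (β * e i)) atTop (𝓝 0) := by
    have := hpart.sub hpart'
    simpa only [Finset.sum_range_succ, add_sub_cancel_left, sub_zero] using this
  have hsum := (NonarchimedeanAddGroup.summable_of_tendsto_cofinite_zero (by
    rwa [Nat.cofinite_eq_atTop])).hasSum
  rwa [tendsto_nhds_unique hsum.tendsto_sum_nat hpart'] at hsum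

end Dual

/-! ## The infinite product -/

section Product

variable {C : Type*} [NontriviallyNormedField C] [IsUltrametricDist C] [CompleteSpace C]

open scoped PowerSeries.WithPiTopology in
-- Coefficientwise Cauchy criterion. Factors beyond radius `R` have a product of Gauss norm at most
-- `1` at radius `R`, so it differs from `1` by coefficients of size at most `1/R`; the head is
-- bounded by a constant `A` independent of `R`.
theorem multipliable_one_sub {ι : Type*} (v : ι ↪ C)
    (hv : ∀ r : ℝ, {i | ‖v i‖ ≤ r}.Finite) :
    Multipliable fun i => (1 - PowerSeries.C (v i)⁻¹ * PowerSeries.X : PowerSeries C) := by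
  have hprod (s : Finset ι) : ∏ i ∈ s, (1 - PowerSeries.C (v i)⁻¹ * PowerSeries.X) =
      ∏ l ∈ s.map v, (1 - PowerSeries.C l⁻¹ * PowerSeries.X) := (Finset.prod_map s v
      fun l => (1 - PowerSeries.C l⁻¹ * PowerSeries.X : PowerSeries C)).symm
  have hcoeff (k : ℕ) : ∃ a, Tendsto (fun s : Finset ι => PowerSeries.coeff k
      (∏ i ∈ s, (1 - PowerSeries.C (v i)⁻¹ * PowerSeries.X))) atTop (𝓝 a) := by
    refine cauchySeq_tendsto_of_complete (Metric.cauchySeq_iff'.2 fun ε hε => ?_)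
    set u := ((hv 1).toFinset.map v)
    set A := ∏ l ∈ u.erase 0, (1 / ‖l‖)
    have hA0 : 0 ≤ A := Finset.prod_nonneg fun _ _ => by positivity
    have hbound (s : Finset ι) (j : ℕ) : ‖PowerSeries.coeff j
        (∏ i ∈ s, (1 - PowerSeries.C (v i)⁻¹ * PowerSeries.X))‖ ≤ A := by
      have h1 := norm_coeff_prod_one_sub_le zero_le_one (s.map v) j
      rw [one_pow, mul_one, ← hprod] at h1
      refine h1.trans (prod_max_le (fun l hl => ?_) fun l hl hl1 => ?_)
      · obtain ⟨i, hi, rfl⟩ := Finset.mem_map.1 hl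
        simpa using hi
      · obtain ⟨i, hi, rfl⟩ := Finset.mem_map.1 hl
        exact Finset.mem_map_of_mem v (by simpa using hl1)
    obtain ⟨R, hR1, hR⟩ : ∃ R : ℝ, 1 ≤ R ∧ A / R < ε := by
      refine ⟨max 1 (A / ε + 1), le_max_left _ _, ?_⟩
      rw [div_lt_comm₀ (by positivity) hε]
      exact lt_of_lt_of_le (lt_add_one _) (le_max_right _ _)
    have hR0 : 0 < R := by linarith
    refine ⟨(hv R).toFinset, fun s hs => ?_⟩
    rw [dist_eq_norm, ← map_sub, ← Finset.prod_sdiff hs, ← sub_one_mul]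
    refine lt_of_le_of_lt ?_ hR
    have htail (j : ℕ) : ‖PowerSeries.coeff j (∏ i ∈ s \ (hv R).toFinset,
        (1 - PowerSeries.C (v i)⁻¹ * PowerSeries.X) - 1)‖ ≤ R⁻¹ := by
      rcases j with - | j
      · simp [map_prod, hR0.le]
      · rw [map_sub, PowerSeries.coeff_one, if_neg j.succ_ne_zero, sub_zero, hprod]
        have h1 := norm_coeff_prod_one_sub_le hR0.le ((s \ (hv R).toFinset).map v) (j + 1)
        have h2 : ∏ l ∈ (s \ (hv R).toFinset).map v, max 1 (R / ‖l‖) = 1 := by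
          refine Finset.prod_eq_one fun l hl => ?_
          obtain ⟨i, hi, rfl⟩ := Finset.mem_map.1 hl
          have : R < ‖v i‖ := by simpa using (Finset.mem_sdiff.1 hi).2
          exact max_eq_left ((div_le_one (hR0.trans this)).2 this.le)
        rw [h2, ← le_div_iff₀ (by positivity), one_div] at h1
        exact h1.trans (inv_anti₀ hR0 (le_self_pow₀ hR1 j.succ_ne_zero))
    have := norm_coeff_mul_le zero_le_one (fun j => by
      rw [one_pow, mul_one]
      exact htail j) (fun j => by
      rw [one_pow, mul_one]
      exact hbound (hv R).toFinset j) k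
    rwa [one_pow, mul_one, ← div_eq_inv_mul] at this
  choose a ha using hcoeff
  refine ⟨PowerSeries.mk a, ?_⟩
  refine (PowerSeries.WithPiTopology.tendsto_iff_coeff_tendsto C _ _ _).2 fun k => ?_
  rw [PowerSeries.coeff_mk]
  exact ha k

end Product

/-! ## Discrete lattices are strongly discrete -/

/-- Generators span a finite-dimensional, hence proper, `F`-space containing `Λ`; a discrete
subgroup is closed and meets compact balls in finite sets. -/
theorem finite_inter_closedBall_of_fg {F C A : Type*} [NontriviallyNormedField F] [CompleteSpace F]
    [ProperSpace F] [NontriviallyNormedField C] (φ : F →+* C) (hφ : ∀ x, ‖φ x‖ = ‖x‖)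
    [CommRing A] [Module A C] (hA : ∀ a : A, ∃ c : F, ∀ x : C, a • x = φ c * x)
    (Λ : Submodule A C) (hfg : Λ.FG) (hdisc : DiscreteTopology Λ) (r : ℝ) :
    ((Λ : Set C) ∩ Metric.closedBall 0 r).Finite := by
  have hsmul (a : F) (x : C) : ‖φ a * x‖ ≤ ‖a‖ * ‖x‖ := by rw [norm_mul, hφ]
  let _ : NormedAlgebra F C := { φ.toAlgebra with norm_smul_le := hsmul }
  obtain ⟨S, hS⟩ := hfg
  let V : Submodule F C := Submodule.span F (S : Set C)
  have hΛV : ∀ x ∈ Λ, x ∈ V := by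
    intro x hx
    rw [← hS] at hx
    refine Submodule.span_induction (fun x hx => Submodule.subset_span hx) V.zero_mem
      (fun x y _ _ => V.add_mem) (fun a x _ hx => ?_) hx
    obtain ⟨c, hc⟩ := hA a
    rw [hc]
    exact V.smul_mem c hx
  have : FiniteDimensional F V := FiniteDimensional.span_finset F S
  have : ProperSpace V := FiniteDimensional.proper F V
  let G : AddSubgroup V := Λ.toAddSubgroup.comap V.subtype.toAddMonoidHom
  have hG : DiscreteTopology G := by
    change DiscreteTopology ((Subtype.val : V → C) ⁻¹' (Λ : Set C))
    have : DiscreteTopology (Λ : Set C) := hdisc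
    exact DiscreteTopology.preimage_of_continuous_injective _ continuous_subtype_val
      Subtype.val_injective
  have hfin := Metric.finite_isBounded_inter_isClosed (s := (G : Set V))
    DiscreteTopology.isDiscrete (Metric.isBounded_closedBall (x := 0) (r := r))
    AddSubgroup.isClosed_of_discrete
  refine (hfin.image Subtype.val).subset ?_
  rintro x ⟨hx, hxr⟩
  refine ⟨⟨x, hΛV x hx⟩, ⟨?_, hx⟩, rfl⟩
  rw [mem_closedBall_zero_iff] at hxr ⊢
  exact hxr

theorem isUltrametricDist_completion (E : Type*) [SeminormedAddCommGroup E] [IsUltrametricDist E] :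
    IsUltrametricDist (UniformSpace.Completion E) :=
  IsUltrametricDist.isUltrametricDist_of_forall_norm_add_le_max_norm fun x y => by
    induction x, y using UniformSpace.Completion.induction_on₂ with
    | hp => exact isClosed_le (by fun_prop) (by fun_prop)
    | ih x y =>
      rw [← UniformSpace.Completion.coe_add]
      simpa only [UniformSpace.Completion.norm_coe] using
        IsUltrametricDist.norm_add_le_max x y

/-! ### Local compactness of the completion at a rational point -/

namespace ClosedPoint

variable {Fq K : Type*} [Field Fq] [Field K] [Algebra Fq K] [Fintype Fq] (P : ClosedPoint Fq K)

theorem mem_localRing_of_abv_le_one {x : K} (hx : P.abv x ≤ 1) : x ∈ P.localRing := by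
  have h1 : (1 : NNReal) < (Fintype.card Fq : NNReal) := by exact_mod_cast Fintype.one_lt_card
  have h2 := (WithZeroMulInt.toNNReal_le_one_iff (m :=
    (IsDiscreteValuationRing.maximalIdeal P.localRing).valuation K x) h1).1 (by exact_mod_cast hx)
  obtain ⟨a, rfl⟩ := IsDiscreteValuationRing.exists_lift_of_le_one h2
  exact a.2

theorem abv_lt_one_of_mem_maximalIdeal {a : P.localRing}
    (ha : a ∈ IsLocalRing.maximalIdeal P.localRing) : P.abv (a : K) < 1 := by
  have h1 : (1 : NNReal) < (Fintype.card Fq : NNReal) := by exact_mod_cast Fintype.one_lt_card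
  have h2 := (WithZeroMulInt.toNNReal_lt_one_iff (m :=
    (IsDiscreteValuationRing.maximalIdeal P.localRing).valuation K (a : K)) h1).2
    ((IsDedekindDomain.HeightOneSpectrum.valuation_lt_one_iff_mem _ _).2 ha)
  exact_mod_cast h2

theorem abv_coe_le_one (a : P.localRing) : P.abv (a : K) ≤ 1 := by
  have h1 : (1 : NNReal) < (Fintype.card Fq : NNReal) := by exact_mod_cast Fintype.one_lt_card
  have h2 := (WithZeroMulInt.toNNReal_le_one_iff (m :=
    (IsDiscreteValuationRing.maximalIdeal P.localRing).valuation K (a : K)) h1).2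
    (IsDedekindDomain.HeightOneSpectrum.valuation_le_one _ _)
  exact_mod_cast h2

variable {P}

theorem IsRational.exists_abv_sub_le (hP : P.IsRational) {ϖ : P.localRing} (hϖ : Irreducible ϖ)
    {x : K} (hx : P.abv x ≤ 1) :
    ∃ c : Fq, P.abv (x - algebraMap Fq K c) ≤ P.abv (ϖ : K) := by
  have hx' := P.mem_localRing_of_abv_le_one hx
  obtain ⟨c, hc⟩ := hP x hx'
  refine ⟨c, ?_⟩
  let a : P.localRing := ⟨x, hx'⟩ - ⟨algebraMap Fq K c, P.algebraMap_mem c⟩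
  have ha : a ∈ IsLocalRing.maximalIdeal P.localRing :=
    (P.localRing.valuation_lt_one_iff a).2 hc
  rw [hϖ.maximalIdeal_eq, Ideal.mem_span_singleton] at ha
  obtain ⟨b, hb⟩ := ha
  have : x - algebraMap Fq K c = (ϖ : K) * (b : K) := congrArg Subtype.val hb
  rw [this, map_mul]
  exact mul_le_of_le_one_right (P.abv.nonneg _) (P.abv_coe_le_one b)

/-- The net consists of the `ϖ`-adic expansions with `n` digits in `Fq`. -/
theorem IsRational.exists_finite_net (hP : P.IsRational) {ϖ : P.localRing} (hϖ : Irreducible ϖ)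
    (n : ℕ) : ∃ N : Set K, N.Finite ∧
      ∀ x : K, P.abv x ≤ 1 → ∃ y ∈ N, P.abv (x - y) ≤ P.abv (ϖ : K) ^ n := by
  have hϖ0 : (ϖ : K) ≠ 0 := fun h => hϖ.ne_zero (Subtype.ext h)
  have hpos : 0 < P.abv (ϖ : K) := P.abv.pos hϖ0
  induction n with
  | zero => exact ⟨{0}, Set.finite_singleton 0, fun x hx => ⟨0, rfl, by simpa using hx⟩⟩
  | succ n ih =>
    obtain ⟨N, hN, h⟩ := ih
    refine ⟨Set.image2 (fun y (c : Fq) => y + (ϖ : K) ^ n * algebraMap Fq K c) N Set.univ,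
      hN.image2 _ Set.finite_univ, fun x hx => ?_⟩
    obtain ⟨y, hy, hxy⟩ := h x hx
    have hz : P.abv ((x - y) / (ϖ : K) ^ n) ≤ 1 := by
      rw [map_div₀, map_pow]
      exact (div_le_one (pow_pos hpos n)).2 hxy
    obtain ⟨c, hc⟩ := hP.exists_abv_sub_le hϖ hz
    refine ⟨_, ⟨y, hy, c, Set.mem_univ c, rfl⟩, ?_⟩
    have : x - (y + (ϖ : K) ^ n * algebraMap Fq K c) =
        (ϖ : K) ^ n * ((x - y) / (ϖ : K) ^ n - algebraMap Fq K c) := by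
      field_simp
      ring
    rw [this, map_mul, map_pow, pow_succ]
    exact mul_le_mul_of_nonneg_left hc (by positivity)

theorem IsRational.properSpace_KInf (hP : P.IsRational) : ProperSpace P.KInf := by
  obtain ⟨ϖ, hϖ⟩ := IsDiscreteValuationRing.exists_irreducible P.localRing
  have hϖ1 : P.abv (ϖ : K) < 1 := P.abv_lt_one_of_mem_maximalIdeal (by
    rw [hϖ.maximalIdeal_eq]
    exact Ideal.mem_span_singleton_self ϖ)
  have htb : TotallyBounded (Metric.closedBall (0 : P.KInf) 1) := by
    rw [Metric.totallyBounded_iff]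
    intro ε hε
    obtain ⟨n, hn⟩ := exists_pow_lt_of_lt_one hε hϖ1
    obtain ⟨N, hN, h⟩ := hP.exists_finite_net hϖ n
    refine ⟨(fun y : K => ((WithAbs.toAbs P.abv y : WithAbs P.abv) : P.KInf)) '' N,
      hN.image _, fun x hx => ?_⟩
    rw [mem_closedBall_zero_iff] at hx
    -- An approximation within `1` keeps `k` in the unit ball.
    obtain ⟨k, hk⟩ := (UniformSpace.Completion.denseRange_coe (α := WithAbs P.abv)).exists_dist_lt
      x (lt_min hε one_pos)
    obtain ⟨hkε, hk1⟩ := lt_min_iff.1 hk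
    rw [dist_eq_norm] at hkε hk1
    have hk' : P.abv k.ofAbs ≤ 1 := by
      change ‖k‖ ≤ 1
      rw [← UniformSpace.Completion.norm_coe k]
      have : (k : P.KInf) = x + -(x - k) := by ring
      rw [this]
      exact (IsUltrametricDist.norm_add_le_max _ _).trans (max_le hx (by
        rw [norm_neg]
        exact hk1.le))
    obtain ⟨y, hy, hky⟩ := h _ hk'
    refine Set.mem_biUnion (Set.mem_image_of_mem _ hy) ?_
    rw [Metric.mem_ball, dist_eq_norm, ← sub_add_sub_cancel x (k : P.KInf)]
    refine (IsUltrametricDist.norm_add_le_max _ _).trans_lt (max_lt hkε ?_)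
    rw [← UniformSpace.Completion.coe_sub, UniformSpace.Completion.norm_coe]
    exact lt_of_le_of_lt hky hn
  have hc : IsCompact (Metric.closedBall (0 : P.KInf) 1) :=
    isCompact_iff_totallyBounded_isComplete.2 ⟨htb, Metric.isClosed_closedBall.isComplete⟩
  have := hc.locallyCompactSpace_of_mem_nhds_of_addGroup (Metric.closedBall_mem_nhds 0 one_pos)
  exact ProperSpace.of_nontriviallyNormedField_of_weaklyLocallyCompactSpace P.KInf

instance (P : ClosedPoint Fq K) : IsUltrametricDist P.KInfAlg :=
  IsUltrametricDist.isUltrametricDist_of_forall_norm_add_le_max_norm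
    (isNonarchimedean_spectralNorm (K := P.KInf) (L := P.KInfAlg))

instance (P : ClosedPoint Fq K) : IsUltrametricDist P.CInf :=
  isUltrametricDist_completion P.KInfAlg

theorem norm_algebraMap_KInf (x : P.KInf) :
    ‖algebraMap P.KInfAlg P.CInf (algebraMap P.KInf P.KInfAlg x)‖ = ‖x‖ :=
  (UniformSpace.Completion.norm_coe (algebraMap P.KInf P.KInfAlg x)).trans
    (spectralNorm_extends x)

theorem finite_inter_closedBall (hP : P.IsRational) (Λ : Submodule P.ringAway P.CInf)
    (hfg : Λ.FG) (hdisc : DiscreteTopology Λ) (r : ℝ) :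
    ((Λ : Set P.CInf) ∩ Metric.closedBall 0 r).Finite := by
  have := hP.properSpace_KInf
  exact finite_inter_closedBall_of_fg (A := P.ringAway)
    ((algebraMap P.KInfAlg P.CInf).comp (algebraMap P.KInf P.KInfAlg)) norm_algebraMap_KInf
    (fun a => ⟨algebraMap (WithAbs P.abv) P.KInf (WithAbs.toAbs P.abv (a : K)),
      fun x => rfl⟩) Λ hfg hdisc r

end ClosedPoint

/-! ### From the kernel to linear forms -/

section Duality

variable {Fq C : Type*} [Field Fq] [Fintype Fq] [NontriviallyNormedField C] [Algebra Fq C]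
  [IsUltrametricDist C] [CompleteSpace C] {L : Submodule Fq C} {hL : StronglyDiscrete L} {e : ℕ → C}

namespace StronglyDiscrete

open scoped PowerSeries.WithPiTopology in
-- An unconditional product may be computed along the exhaustion by balls.
theorem isExpCoeff_tprod (hL : StronglyDiscrete L) : hL.IsExpCoeff fun n =>
    PowerSeries.coeff (Fintype.card Fq ^ n) (PowerSeries.X * ∏' l : {l : L // l ≠ 0},
      (1 - PowerSeries.C ((l : L) : C)⁻¹ * PowerSeries.X)) := by
  intro n
  have hmul := multipliable_one_sub (nonzeroEmb L) fun r =>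
    (hL.nonzeroBall r).finite_toSet.subset fun l hl => hL.mem_nonzeroBall.2 hl
  have hprod : HasProd (fun l : {l : L // l ≠ 0} =>
      (1 - PowerSeries.C ((l : L) : C)⁻¹ * PowerSeries.X : PowerSeries C)) _ := hmul.hasProd
  have hlim := ((PowerSeries.WithPiTopology.continuous_coeff C
    (Fintype.card Fq ^ n)).tendsto _).comp
    (Tendsto.const_mul PowerSeries.X (Tendsto.comp hprod hL.tendsto_nonzeroBall))
  refine hlim.congr fun m => ?_
  have hm := Finset.prod_map (hL.nonzeroBall m) (nonzeroEmb L)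
    fun l => (1 - PowerSeries.C l⁻¹ * PowerSeries.X : PowerSeries C)
  rw [hL.map_nonzeroBall] at hm
  rw [← Polynomial.coeff_coe, coe_expPoly, hm]
  rfl

theorem IsExpCoeff.exists_linearMap (he : hL.IsExpCoeff e) {β : C}
    (hB : ∀ r : ℝ, 0 < r → ∃ B, ∀ n, ‖poonenCoeff Fq e β n‖ * r ^ Fintype.card Fq ^ n ≤ B) :
    ∃ f : L →ₗ[Fq] Fq,
      (∀ l : L, HasSum (fun n => poonenCoeff Fq e β n * (l : C) ^ Fintype.card Fq ^ n)
        (algebraMap Fq C (f l))) ∧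
      HasSum (fun l : {l : L // l ≠ 0} => algebraMap Fq C (f l) / (l : C)) (-β) := by
  have hex (l : L) : ∃ a : Fq, HasSum
      (fun n => poonenCoeff Fq e β n * (l : C) ^ Fintype.card Fq ^ n) (algebraMap Fq C a) := by
    obtain ⟨B, hB⟩ := hB (‖(l : C)‖ + 1) (by positivity)
    exact exists_hasSum_algebraMap_of_hasSum_zero (lt_add_one _) hB (he.hasSum_zero l.2)
  choose f hf using hex
  have hinj := (algebraMap Fq C).injective
  let f' : L →ₗ[Fq] Fq :=
    { toFun := f
      map_add' := fun x y => hinj ((hf (x + y)).unique (by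
        rw [map_add]
        convert (hf x).add (hf y) using 1
        funext n
        rw [← mul_add, ← add_pow_card_pow, Submodule.coe_add]))
      map_smul' := fun a x => hinj ((hf (a • x)).unique (by
        rw [RingHom.id_apply, smul_eq_mul, map_mul]
        refine ((hf x).mul_left (algebraMap Fq C a)).congr_fun fun n => ?_
        rw [Submodule.coe_smul, smul_pow_card_pow, Algebra.smul_def, mul_left_comm])) }
  refine ⟨f', hf, ?_⟩
  let F : C → C := fun x => ∑' n, poonenCoeff Fq e β n * x ^ Fintype.card Fq ^ n
  have hF (l : L) : F l = algebraMap Fq C (f l) := (hf l).tsum_eq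
  have hsum := (hL.summable_div (F := F) fun l hl => by
    rw [hF ⟨l, hl⟩]
    exact norm_algebraMap_le_one _).hasSum
  -- The sum exists unconditionally, so its value can be found along balls, where the residue
  -- estimate applies.
  rw [tendsto_nhds_unique (hL.tendsto_sum_ball (F := fun x => F x / x) hsum)
    (he.tendsto_sum hB)] at hsum
  exact hsum.congr_fun fun l => by rw [hF]; rfl

end StronglyDiscrete

end Duality

/-! ### Translation to twisted series -/

namespace ClosedPoint

variable {Fq K : Type*} [Field Fq] [Field K] [Algebra Fq K] [Fintype Fq] {P : ClosedPoint Fq K}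

theorem frob_apply (x : P.CInf) : P.frob x = x ^ Fintype.card Fq := rfl

/-- After `τ⁻ⁿ` both sides are the partial sums of `exp_Λ^*(β)`, since division by `1 - τ⁻¹` is
partial summation. -/
theorem coeff_poonenSeries (Λ : Submodule P.ringAway P.CInf) (β : P.CInf) (n : ℕ) :
    (poonenSeries Λ β).coeff n = poonenCoeff Fq (expSeries Λ).coeff β n := by
  have hconst (n : ℕ) : (dualExpSeries Λ * TwistedSeries.const β).coeff n =
      P.frob.symm^[n] (β * (expSeries Λ).coeff n) := by
    change ∑ ij ∈ Finset.HasAntidiagonal.antidiagonal n, _ = _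
    rw [Finset.sum_eq_single (n, 0)]
    · rw [iterate_map_mul, mul_comm]
      rfl
    · rintro ⟨i, j⟩ hij hne
      have hj : j ≠ 0 := by
        rintro rfl
        exact hne (by simpa using hij)
      simp [TwistedSeries.const, hj, iterate_map_zero]
    · simp
  have hspec (n : ℕ) := congrArg (fun F => TwistedSeries.coeff F n) (poonenSeries_spec Λ β)
  simp only [hconst] at hspec
  apply P.frob.symm.injective.iterate n
  rw [symm_iterate_poonenCoeff frob_apply]
  induction n with
  | zero =>
    rw [Finset.sum_range_one, hspec, TwistedSeries.coeff_zero_mul_oneSub]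
    rfl
  | succ n ih =>
    rw [Finset.sum_range_succ, ← ih, hspec, TwistedSeries.coeff_succ_mul_oneSub]
    exact (add_sub_cancel _ _).symm

theorem hasEval_poonenSeries_iff {Λ : Submodule P.ringAway P.CInf} {β x y : P.CInf} :
    (poonenSeries Λ β).HasEval x y ↔
      HasSum (fun n => poonenCoeff Fq (expSeries Λ).coeff β n * x ^ Fintype.card Fq ^ n) y := by
  simp only [TwistedSeries.HasEval, coeff_poonenSeries, iterate_eq_pow frob_apply]

theorem mem_kerDualExp_iff {Λ : Submodule P.ringAway P.CInf} {β : P.CInf} :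
    β ∈ kerDualExp Λ ↔
      ∀ r : ℝ, 0 < r → ∃ B, ∀ n,
        ‖poonenCoeff Fq (expSeries Λ).coeff β n‖ * r ^ Fintype.card Fq ^ n ≤ B := by
  have h : β ∈ kerDualExp Λ ↔
      HasSum (fun i => P.frob.symm^[i] (β * (expSeries Λ).coeff i)) 0 := by
    simp only [iterate_map_mul, mul_comm _ (P.frob.symm^[_] ((expSeries Λ).coeff _))]
    rfl
  rw [h]
  exact ⟨fun h r => poonenCoeff_bounded_of_hasSum frob_apply h,
    hasSum_of_poonenCoeff_bounded frob_apply⟩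

end ClosedPoint

end

theorem mainTheorem8 {Fq K : Type*} [Field Fq] [Fintype Fq] [Field K] [Algebra Fq K]
    (hK : IsCurveFunctionField Fq K) (P : ClosedPoint Fq K) (hP : P.IsRational)
    (Λ : Submodule P.ringAway P.CInf) (hfg : Λ.FG) (hdisc : DiscreteTopology Λ) :
    (∀ β ∈ ClosedPoint.kerDualExp Λ, β ≠ 0 →
      (∀ l : Λ, ∃ y, (ClosedPoint.poonenSeries Λ β).HasEval (l : P.CInf) y) ∧
      HasSum (fun l : {l : Λ // l ≠ 0} =>
        (ClosedPoint.poonenSeries Λ β).eval ((l : Λ) : P.CInf) / ((l : Λ) : P.CInf)) (-β)) ∧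
    ∃ e : ClosedPoint.kerDualExp Λ ≃ (Λ →ₗ[Fq] Fq),
      (∀ (β : ClosedPoint.kerDualExp Λ) (l : Λ),
        (ClosedPoint.poonenSeries Λ β).HasEval (l : P.CInf) (algebraMap Fq P.CInf (e β l))) ∧
      ∀ f : Λ →ₗ[Fq] Fq,
        HasSum (fun l : {l : Λ // l ≠ 0} =>
          algebraMap Fq P.CInf (f l) / ((l : Λ) : P.CInf)) (-(e.symm f : P.CInf)) := by
  classical
  have hL : StronglyDiscrete (Λ.restrictScalars Fq) :=
    ClosedPoint.finite_inter_closedBall hP Λ hfg hdisc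
  have he : hL.IsExpCoeff (ClosedPoint.expSeries Λ).coeff := hL.isExpCoeff_tprod
  have hinj := (algebraMap Fq P.CInf).injective
  have hker (β : ClosedPoint.kerDualExp Λ) : ∃ f : Λ →ₗ[Fq] Fq,
      (∀ l : Λ, (ClosedPoint.poonenSeries Λ β).HasEval (l : P.CInf) (algebraMap Fq P.CInf (f l))) ∧
      HasSum (fun l : {l : Λ // l ≠ 0} => algebraMap Fq P.CInf (f l) / ((l : Λ) : P.CInf))
        (-(β : P.CInf)) := by
    obtain ⟨f, hf, hβ⟩ := he.exists_linearMap (ClosedPoint.mem_kerDualExp_iff.1 β.2)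
    exact ⟨f, fun l => ClosedPoint.hasEval_poonenSeries_iff.2 (hf l), hβ⟩
  have hmap (f : Λ →ₗ[Fq] Fq) : ∃ β : ClosedPoint.kerDualExp Λ,
      (∀ l : Λ, (ClosedPoint.poonenSeries Λ β).HasEval (l : P.CInf) (algebraMap Fq P.CInf (f l))) ∧
      HasSum (fun l : {l : Λ // l ≠ 0} => algebraMap Fq P.CInf (f l) / ((l : Λ) : P.CInf))
        (-(β : P.CInf)) := by
    let F : P.CInf → P.CInf := fun x => if hx : x ∈ Λ then algebraMap Fq P.CInf (f ⟨x, hx⟩) else 0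
    have hF (l : Λ) : F l = algebraMap Fq P.CInf (f l) := dif_pos l.2
    have hsum := (hL.summable_div (F := F) fun l hl => by
      rw [hF ⟨l, hl⟩]
      exact norm_algebraMap_le_one _).hasSum
    have hsum' : HasSum (fun l : {l : Λ // l ≠ 0} =>
        algebraMap Fq P.CInf (f l) / ((l : Λ) : P.CInf)) _ :=
      hsum.congr_fun fun l => by rw [← hF]
    -- The candidate preimage is `β = -∑ f(λ)/λ`.
    rw [← neg_neg (tsum _)] at hsum'
    obtain ⟨h1, h2⟩ := he.hasSum_of_linearMap f hsum'
    exact ⟨⟨_, ClosedPoint.mem_kerDualExp_iff.2 h1⟩,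
      fun l => ClosedPoint.hasEval_poonenSeries_iff.2 (h2 l), hsum'⟩
  choose toMap hto hto' using hker
  choose ofMap hof hof' using hmap
  refine ⟨fun β hβ _ => ⟨fun l => ⟨_, hto ⟨β, hβ⟩ l⟩, ?_⟩, ⟨toMap, ofMap, fun β => ?_, fun f => ?_⟩,
    hto, hof'⟩
  · exact (hto' ⟨β, hβ⟩).congr_fun fun l => by
      rw [TwistedSeries.eval, (hto ⟨β, hβ⟩ l).tsum_eq]
  -- Both elements are minus the sum of the same family, so uniqueness of sums gives one inverse
  -- law; uniqueness of the values of `g` gives the other.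
  · exact Subtype.ext (neg_injective ((hof' (toMap β)).unique (hto' β)))
  · exact LinearMap.ext fun l => hinj ((hto (ofMap f) l).unique (hof f l))
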